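/- **Setting.** Let $X$ be an $\mathbb{R}^d$-valued random vector on a probability space with measure $P_f$, let $\Psi:\mathbb{R}^d\to\mathbb{R}$ be measurable with $\Psi(X)$ integrable, and let $\mu=\mathbb{E}(\Psi(X))$. Let $T=T(X)$ be a real-valued measurable function of $X$ that has a Lebesgue density $f_T$, and fix a regular conditional distribution of $X$ given $T$. Put $m(t)=\mathbb{E}(\Psi(X)\mid T=t)$, $m^{(2)}(t)=\mathbb{E}(\Psi(X)^2\mid T=t)$, $v^2(t)=\operatorname{Var}(\Psi(X)\mid T=t)$, the last two with values in $[0,\infty]$, and $v=\sqrt{v^2}$. For a probability density $g$ on $\mathbb{R}$ (the proposal) let $w=f_T/g$, let $\Omega_g=\{t:g(t)>0\}$, let $G$ be the distribution function of $g$ and $G^{-1}(u)=\inf\{t: G(t)\ge u\}$. For $n\ge 1$ the stratified single-index importance sampling (SSIS) estimator is $$\hat\mu_n=\hat\mu_n(g)=\frac1n\sum_{i=1}^n\Psi(X_i)\,w(T_i),\qquad T_i=G^{-1}(U_i),\quad U_i\sim \mathrm{U}\big(\tfrac{i-1}{n},\tfrac in\big),$$ where $X_i$ given $T_i$ is drawn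 from the conditional distribution of $X$ given $T=T_i$, and the pairs $(T_i,X_i)$, $i=1,\dots,n$, are independent. It is called unbiased if $\mathbb{E}(\hat\mu_n)=\mu$ for all $n\ge1$. Let $$\mu_{\mathrm{SIS}}(g)=\int_{\Omega_g}m(t)f_T(t)\,dt,\qquad \sigma^2_{\mathrm{SSIS}}(g)=\int_{\Omega_g}v^2(t)\frac{f_T^2(t)}{g(t)}\,dt .$$ **Proposition (Variance-optimal SSIS).** 1. For every density $g$ and every $n\ge1$, $\hat\mu_n$ is integrable and $\mathbb{E}(\hat\mu_n)=\mu_{\mathrm{SIS}}(g)$. 2. If $\mathbb{E}_g\big(m^{(2)}(T)w^2(T)\big)<\infty$, then $\sigma^2_{\mathrm{SSIS}}(g)<\infty$, $\hat\mu_n$ is square integrable for every $n\ge1$, and $\operatorname{Var}(\hat\mu_n)=\sigma^2_{\mathrm{SSIS}}(g)/n+o(1/n)$ as $n\to\infty$. 3. If $\mathbb{E}_g\big(m^{(2)}(T)w^2(T)\big)<\infty$ and $\mathbb{E}_g\big(|m(T)w(T)|^{2+\delta}\big)<\infty$ for some $\delta>0$, then $\sqrt n\,(\hat\mu_n-\mu_{\mathrm{SIS}}(g))\to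 \mathrm{N}(0,\sigma^2_{\mathrm{SSIS}}(g))$ in distribution as $n\to\infty$. 4. Suppose that $\Psi(X)\ge0$ almost surely or $\Psi(X)\le0$ almost surely, and that $c=\int_{\mathbb{R}}v(t)f_T(t)\,dt$ satisfies $0<c<\infty$. Then $g^{\mathrm{opt}}(t)=c^{-1}v(t)f_T(t)$ is a probability density, and the following hold. (a) If $P_f(v^2(T)=0,\ m(T)\ne0)=0$, then the SSIS estimator with proposal $g^{\mathrm{opt}}$ is unbiased and $\sigma^2_{\mathrm{SSIS}}(g^{\mathrm{opt}})=c^2$; for every density $g$ whose SSIS estimator is unbiased, $\sigma^2_{\mathrm{SSIS}}(g)\ge c^2$, with equality only if $g=g^{\mathrm{opt}}$ almost everywhere. If moreover $\mathbb{E}_{g^{\mathrm{opt}}}\big(m^{(2)}(T)w^2(T)\big)<\infty$ (with $w=f_T/g^{\mathrm{opt}}$), then $\hat\mu_n(g^{\mathrm{opt}})$ is square integrable for every $n\ge1$, $\operatorname{Var}(\hat\mu_n(g^{\mathrm{opt}}))=c^2/n+o(1/n)$, and for every density $g$ that gives an unbiased SSIS estimator and is not almost everywhere equal to $g^{\mathrm{opt}}$,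 $\operatorname{Var}(\hat\mu_n(g^{\mathrm{opt}}))<\operatorname{Var}(\hat\mu_n(g))\le\infty$ for all sufficiently large $n$. (b) If $P_f(v^2(T)=0,\ m(T)\ne0)>0$, then $\hat\mu_n(g^{\mathrm{opt}})$ is biased: $\mathbb{E}(\hat\mu_n(g^{\mathrm{opt}}))\ne\mu$ for every $n\ge1$. -/

import Mathlib

open MeasureTheory ProbabilityTheory Filter Asymptotics
open scoped ENNReal NNReal Topology

namespace SSIS

noncomputable section

/-- `g` is a probability density on the real line (with respect to Lebesgue measure). -/
structure IsDensity (g : ℝ → ℝ) : Prop where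
  measurable : Measurable g
  nonneg : ∀ t, 0 ≤ g t
  lintegral_eq_one : ∫⁻ t, ENNReal.ofReal (g t) = 1

/-- The distribution on `ℝ` with Lebesgue density `g`. -/
def densityMeasure (g : ℝ → ℝ) : Measure ℝ :=
  volume.withDensity (fun t => ENNReal.ofReal (g t))

/-- The quantile function `u ↦ inf {t : G(t) ≥ u}`, `G` being the distribution function of
the density `g`. -/
def quantile (g : ℝ → ℝ) (u : ℝ) : ℝ := sInf {t : ℝ | u ≤ cdf (densityMeasure g) t}

/-- The uniform distribution on the interval `(i/n, (i+1)/n)`, for `i = 0, …, n-1`. -/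
def stratumUniform (n : ℕ) (i : Fin n) : Measure ℝ :=
  ProbabilityTheory.cond volume (Set.Ioo ((i : ℝ) / n) (((i : ℝ) + 1) / n))

/-- The importance sampling weight `w = f / g`. -/
def weight (f g : ℝ → ℝ) (t : ℝ) : ℝ := f t / g t

section Conditional

variable {E : Type*} [MeasurableSpace E]

/-- The conditional mean `m(t) = E(Ψ(X) | T = t)`, where `κ t` is the law of `X` given `T = t`. -/
def condMean (κ : Kernel ℝ E) (Ψ : E → ℝ) (t : ℝ) : ℝ := ∫ x, Ψ x ∂(κ t)

/-- The conditional second moment `m⁽²⁾(t) = E(Ψ(X)² | T = t)`, in `[0, ∞]`. -/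
def condSecondMoment (κ : Kernel ℝ E) (Ψ : E → ℝ) (t : ℝ) : ℝ≥0∞ :=
  ∫⁻ x, ENNReal.ofReal (Ψ x ^ 2) ∂(κ t)

/-- The conditional variance `v²(t) = Var(Ψ(X) | T = t)`, in `[0, ∞]`. -/
def condVar (κ : Kernel ℝ E) (Ψ : E → ℝ) (t : ℝ) : ℝ≥0∞ := evariance Ψ (κ t)

/-- The conditional standard deviation `v(t)`, in `[0, ∞]`. -/
def condSD (κ : Kernel ℝ E) (Ψ : E → ℝ) (t : ℝ) : ℝ≥0∞ := condVar κ Ψ t ^ (1 / 2 : ℝ)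

/-- `μ_SIS = ∫_{g > 0} m(t) f(t) dt`. -/
def muSIS (κ : Kernel ℝ E) (Ψ : E → ℝ) (f g : ℝ → ℝ) : ℝ :=
  ∫ t in {t | 0 < g t}, condMean κ Ψ t * f t

/-- `σ²_SSIS = ∫_{g > 0} v²(t) f(t)² / g(t) dt`, in `[0, ∞]`. -/
def sigmaSqSSIS (κ : Kernel ℝ E) (Ψ : E → ℝ) (f g : ℝ → ℝ) : ℝ≥0∞ :=
  ∫⁻ t in {t | 0 < g t}, condVar κ Ψ t * ENNReal.ofReal (f t ^ 2 / g t)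

/-- `E_g(Ψ(X)² w(T)²) = E_g(m⁽²⁾(T) w(T)²)`, in `[0, ∞]`. -/
def weightedSecondMoment (κ : Kernel ℝ E) (Ψ : E → ℝ) (f g : ℝ → ℝ) : ℝ≥0∞ :=
  ∫⁻ t, condSecondMoment κ Ψ t * ENNReal.ofReal (weight f g t ^ 2) ∂(densityMeasure g)

/-- `E_g(|m(T) w(T)|^p)`, in `[0, ∞]`. -/
def weightedMeanMoment (κ : Kernel ℝ E) (Ψ : E → ℝ) (f g : ℝ → ℝ) (p : ℝ) : ℝ≥0∞ :=
  ∫⁻ t, ENNReal.ofReal (|condMean κ Ψ t * weight f g t| ^ p) ∂(densityMeasure g)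

/-- `c = ∫ v(t) f(t) dt`, in `[0, ∞]`. -/
def optConst (κ : Kernel ℝ E) (Ψ : E → ℝ) (f : ℝ → ℝ) : ℝ≥0∞ :=
  ∫⁻ t, condSD κ Ψ t * ENNReal.ofReal (f t)

/-- The proposal `g_opt(t) = c⁻¹ v(t) f(t)` (meaningful when `0 < c < ∞`; then `v` is finite
almost everywhere where `f > 0`). -/
def optDensity (κ : Kernel ℝ E) (Ψ : E → ℝ) (f : ℝ → ℝ) (t : ℝ) : ℝ :=
  (optConst κ Ψ f).toReal⁻¹ * (condSD κ Ψ t).toReal * f t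

/-- The joint law of `(T_i, X_i)`: `T_i = G⁻¹(U_i)` with `U_i` uniform on the `i`-th of `n`
subintervals of `(0, 1)`, and `X_i` drawn from `κ T_i` given `T_i`. -/
def stratumLaw (κ : Kernel ℝ E) (g : ℝ → ℝ) (n : ℕ) (i : Fin n) : Measure (ℝ × E) :=
  ((stratumUniform n i).map (quantile g)) ⊗ₘ κ

/-- The law of the stratified sample `((T_1, X_1), …, (T_n, X_n))`: independent draws, one from
each stratum. -/
def sampleLaw (κ : Kernel ℝ E) (g : ℝ → ℝ) (n : ℕ) : Measure (Fin n → ℝ × E) :=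
  Measure.pi (stratumLaw κ g n)

/-- The stratified estimator `(1/n) ∑ Ψ(X_i) w(T_i)`, as a function of the sample. -/
def estimator (Ψ : E → ℝ) (f g : ℝ → ℝ) (n : ℕ) (s : Fin n → ℝ × E) : ℝ :=
  (1 / (n : ℝ)) * ∑ i, Ψ (s i).2 * weight f g (s i).1

/-- The stratified estimator with proposal `g` has mean `μ` for every sample size. -/
def IsUnbiased (κ : Kernel ℝ E) (Ψ : E → ℝ) (f g : ℝ → ℝ) (μ : ℝ) : Prop :=
  ∀ n : ℕ, 1 ≤ n → ∫ s, estimator Ψ f g n s ∂(sampleLaw κ g n) = μ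

end Conditional

theorem monotoneOn_quantile (g : ℝ → ℝ) : MonotoneOn (quantile g) (Set.Ioo 0 1) := by
  intro u hu v hv huv
  refine csInf_le_csInf ?_ ?_ (fun t ht => le_trans huv ht)
  · obtain ⟨a, ha⟩ := ((tendsto_cdf_atBot (densityMeasure g)).eventually_lt_const hu.1).exists
    refine ⟨a, fun t ht => ?_⟩
    by_contra hlt
    exact absurd (lt_of_le_of_lt (le_trans ht ((monotone_cdf _) (not_le.1 hlt).le)) ha)
      (lt_irrefl u)
  · obtain ⟨b, hb⟩ := ((tendsto_cdf_atTop (densityMeasure g)).eventually_const_lt hv.2).exists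
    exact ⟨b, hb.le⟩

theorem stratum_subset (n : ℕ) (i : Fin n) :
    Set.Ioo ((i : ℝ) / n) (((i : ℝ) + 1) / n) ⊆ Set.Ioo 0 1 := by
  have hn : (0 : ℝ) < n := by exact_mod_cast i.pos
  have hi : (i : ℝ) + 1 ≤ n := by exact_mod_cast i.isLt
  intro u hu
  exact ⟨lt_of_le_of_lt (by positivity) hu.1, lt_of_lt_of_le hu.2 ((div_le_one hn).2 hi)⟩

theorem aemeasurable_quantile (g : ℝ → ℝ) (n : ℕ) (i : Fin n) :
    AEMeasurable (quantile g) (stratumUniform n i) := by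
  unfold stratumUniform ProbabilityTheory.cond
  exact (aemeasurable_restrict_of_monotoneOn measurableSet_Ioo
    ((monotoneOn_quantile g).mono (stratum_subset n i))).smul_measure _

instance (n : ℕ) (i : Fin n) : IsProbabilityMeasure (stratumUniform n i) := by
  have hn : (0 : ℝ) < n := by exact_mod_cast i.pos
  unfold stratumUniform
  refine cond_isProbabilityMeasure_of_finite ?_ ?_
  · rw [Real.volume_Ioo, ← sub_div]
    simp [hn]
  · simp

instance {E : Type*} [MeasurableSpace E] (κ : Kernel ℝ E) [IsMarkovKernel κ] (g : ℝ → ℝ)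
    (n : ℕ) (i : Fin n) : IsProbabilityMeasure (stratumLaw κ g n i) := by
  have := Measure.isProbabilityMeasure_map (aemeasurable_quantile g n i)
  unfold stratumLaw
  infer_instance

instance {E : Type*} [MeasurableSpace E] (κ : Kernel ℝ E) [IsMarkovKernel κ] (g : ℝ → ℝ)
    (n : ℕ) : IsProbabilityMeasure (sampleLaw κ g n) := by
  unfold sampleLaw
  infer_instance

end

end SSIS

/-!
Write `w = f / g` for the weight, `m` and `v²` for the conditional mean and variance of `Ψ(X)` given
`T = t`, and `F(t, x) = Ψ(x) w(t)`, so that the estimator is the average of the `F(T_i, X_i)`.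

*Mean and variance.* The quantile function maps the uniform law on `(0, 1)` to the law with density
`g` (`map_quantile`), so the laws of the pairs `(T_i, X_i)` average over the strata to the law `ρ` of
an unstratified pair (`sum_stratumLaw`). Hence the estimator has mean `∫ F dρ = μ_SIS`. By the law of
total variance within each stratum (`variance_compProd`), `n` times the variance of the estimator is
`σ²_SSIS` plus the average over the strata of the variances of `(m w)(T_i)`
(`mul_variance_estimator`). This average tends to `0` for square integrable `m w`: approximate
`m w ∘ G⁻¹` in `L²(0, 1)` by a continuous function, which is nearly constant on short strata
(`tendsto_average_variance`).

*Asymptotic normality.* Each centred summand is `F - m w`, plus the centred `(m w)(T_i)`, which is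
negligible by the above. The truncated second moments of `F - m w` add up over the strata to a
truncated second moment under the one law `ρ`, which vanishes by dominated convergence. So the
Lindeberg condition follows from `F ∈ L²(ρ)` (`tendsto_sum_lindebergFun`), and Lindeberg's theorem
for independent rows (`tendsto_prod_charFun`) with Lévy's continuity theorem gives the limit law.

*Optimality.* As `Ψ` has one sign, so has `m`. Therefore `g` is unbiased if and only if `m f = 0`
almost everywhere on `{g = 0}` (`muSIS_eq_iff`), and there `v f = 0` as well, because a variable of one
sign and mean zero vanishes. Completing the square, `σ²(g) - c² = ∫ (v f / g - c)² g` over `{g > 0}`,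
which gives the lower bound and its uniqueness (`optConst_sq_le_sigmaSqSSIS`). The comparison of the
variances for large `n` follows from their asymptotics if `F ∈ L²(ρ)`; otherwise the variance for `g`
is infinite, because the summands of a square integrable independent sum are square integrable
(`memLp_of_memLp_sum_pi`).
-/

namespace SSIS

/-! ### Quantile transform and averages over the strata -/

section

theorem IsDensity.isProbabilityMeasure {g : ℝ → ℝ} (hg : IsDensity g) :
    IsProbabilityMeasure (densityMeasure g) :=
  ⟨by simp [densityMeasure, hg.lintegral_eq_one]⟩

/-- The Galois connection between the quantile function and the distribution function; it rests on
the right continuity of the latter. -/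
theorem quantile_le_iff (g : ℝ → ℝ) {u : ℝ} (hu : u ∈ Set.Ioo (0 : ℝ) 1) (t : ℝ) :
    quantile g u ≤ t ↔ u ≤ cdf (densityMeasure g) t := by
  set G := cdf (densityMeasure g)
  have hbdd : BddBelow {t : ℝ | u ≤ G t} := by
    obtain ⟨a, ha⟩ := ((tendsto_cdf_atBot (densityMeasure g)).eventually_lt_const hu.1).exists
    refine ⟨a, fun s hs => ?_⟩
    by_contra hlt
    exact absurd (lt_of_le_of_lt (hs.trans (G.mono (not_le.1 hlt).le)) ha) (lt_irrefl u)
  have hne : {t : ℝ | u ≤ G t}.Nonempty := by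
    obtain ⟨b, hb⟩ := ((tendsto_cdf_atTop (densityMeasure g)).eventually_const_lt hu.2).exists
    exact ⟨b, hb.le⟩
  refine ⟨fun h => ?_, fun h => csInf_le hbdd h⟩
  have hs : ∀ s, t < s → u ≤ G s := fun s hts => by
    obtain ⟨r, hr, hrs⟩ := exists_lt_of_csInf_lt hne (lt_of_le_of_lt h hts)
    exact hr.trans (G.mono hrs.le)
  have hlim : Tendsto G (𝓝[>] t) (𝓝 (G t)) :=
    ((G.right_continuous t).mono Set.Ioi_subset_Ici_self).tendsto
  exact ge_of_tendsto hlim (eventually_nhdsWithin_of_forall hs)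

theorem aemeasurable_quantile_Ioo (g : ℝ → ℝ) :
    AEMeasurable (quantile g) (volume.restrict (Set.Ioo 0 1)) :=
  aemeasurable_restrict_of_monotoneOn measurableSet_Ioo (monotoneOn_quantile g)

/-- Inverse transform sampling: `G⁻¹(U)` has density `g` for `U` uniform on `(0, 1)`. -/
theorem map_quantile {g : ℝ → ℝ} (hg : IsDensity g) :
    (volume.restrict (Set.Ioo (0 : ℝ) 1)).map (quantile g) = densityMeasure g := by
  have := hg.isProbabilityMeasure
  have : IsFiniteMeasure ((volume.restrict (Set.Ioo (0 : ℝ) 1)).map (quantile g)) :=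
    Measure.isFiniteMeasure_map _ _
  refine Measure.ext_of_Iic _ _ fun t => ?_
  rw [Measure.map_apply_of_aemeasurable (aemeasurable_quantile_Ioo g) measurableSet_Iic,
    ← ofReal_cdf]
  set c := cdf (densityMeasure g) t with hc
  have h1 : volume.restrict (Set.Ioo (0 : ℝ) 1) (quantile g ⁻¹' Set.Iic t)
      = volume.restrict (Set.Ioo (0 : ℝ) 1) (Set.Iic c) := by
    refine measure_congr ?_
    filter_upwards [ae_restrict_mem measurableSet_Ioo] with u hu
    exact propext (quantile_le_iff g hu t)
  rw [h1, Measure.restrict_congr_set Ioo_ae_eq_Ioc, Measure.restrict_apply measurableSet_Iic]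
  have h2 : Set.Iic c ∩ Set.Ioc 0 1 = Set.Ioc 0 c := by
    ext u
    have : c ≤ 1 := cdf_le_one _ _
    simp only [Set.mem_inter_iff, Set.mem_Iic, Set.mem_Ioc]
    constructor
    · tauto
    · rintro ⟨h, h'⟩; exact ⟨h', h, h'.trans this⟩
  rw [h2, Real.volume_Ioc, sub_zero]

theorem stratumUniform_eq (n : ℕ) (i : Fin n) :
    stratumUniform n i
      = (n : ℝ≥0∞) • volume.restrict (Set.Ico ((i : ℝ) / n) (((i : ℝ) + 1) / n)) := by
  have hn : (0 : ℝ) < n := by exact_mod_cast i.pos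
  rw [stratumUniform, ProbabilityTheory.cond, Measure.restrict_congr_set Ioo_ae_eq_Ico,
    Real.volume_Ioo, ← sub_div, add_sub_cancel_left, one_div, ENNReal.ofReal_inv_of_pos hn,
    inv_inv, ENNReal.ofReal_natCast]

theorem iUnion_Ico_div {n : ℕ} (hn : 1 ≤ n) :
    ⋃ i : Fin n, Set.Ico ((i : ℝ) / n) (((i : ℝ) + 1) / n) = Set.Ico 0 1 := by
  have hn' : (0 : ℝ) < n := by exact_mod_cast hn
  ext u
  simp only [Set.mem_iUnion, Set.mem_Ico, div_le_iff₀ hn', lt_div_iff₀ hn']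
  constructor
  · rintro ⟨i, h1, h2⟩
    have hi : (i : ℝ) + 1 ≤ n := by exact_mod_cast i.isLt
    have : (0 : ℝ) ≤ i := by positivity
    constructor <;> nlinarith
  · rintro ⟨h1, h2⟩
    have h0 : 0 ≤ u * n := by positivity
    refine ⟨⟨⌊u * n⌋₊, (Nat.floor_lt h0).2 (by nlinarith)⟩, Nat.floor_le h0, Nat.lt_floor_add_one _⟩

theorem pairwise_disjoint_Ico_div (n : ℕ) :
    Pairwise (Function.onFun Disjoint
      fun i : Fin n => Set.Ico ((i : ℝ) / n) (((i : ℝ) + 1) / n)) := by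
  have key : ∀ i j : Fin n, i < j → Disjoint (Set.Ico ((i : ℝ) / n) (((i : ℝ) + 1) / n))
      (Set.Ico ((j : ℝ) / n) (((j : ℝ) + 1) / n)) := by
    intro i j hij
    have h : (i : ℝ) + 1 ≤ j := by exact_mod_cast hij
    refine Set.disjoint_left.2 fun u hu hu' => ?_
    have : ((i : ℝ) + 1) / n ≤ j / n := by gcongr
    exact absurd (hu.2.trans_le this) (not_lt.2 hu'.1)
  intro i j hij
  rcases lt_or_gt_of_ne hij with h | h
  · exact key i j h
  · exact (key j i h).symm

/-- The uniform laws on the `n` strata average to the uniform law on `(0, 1)`. -/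
theorem sum_stratumUniform {n : ℕ} (hn : 1 ≤ n) :
    Measure.sum (stratumUniform n) = (n : ℝ≥0∞) • volume.restrict (Set.Ioo (0 : ℝ) 1) := by
  rw [Measure.restrict_congr_set Ioo_ae_eq_Ico, ← iUnion_Ico_div hn,
    Measure.restrict_iUnion (pairwise_disjoint_Ico_div n) fun _ => measurableSet_Ico]
  ext s
  simp [stratumUniform_eq, Finset.mul_sum]

/-- The law of `T_i = G⁻¹(U_i)`, the first marginal of `stratumLaw`. -/
noncomputable def stratumIndexLaw (g : ℝ → ℝ) (n : ℕ) (i : Fin n) : Measure ℝ :=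
  (stratumUniform n i).map (quantile g)

instance (g : ℝ → ℝ) (n : ℕ) (i : Fin n) : IsProbabilityMeasure (stratumIndexLaw g n i) :=
  Measure.isProbabilityMeasure_map (aemeasurable_quantile g n i)

theorem sum_stratumIndexLaw {g : ℝ → ℝ} (hg : IsDensity g) {n : ℕ} (hn : 1 ≤ n) :
    Measure.sum (stratumIndexLaw g n) = (n : ℝ≥0∞) • densityMeasure g := by
  rw [← map_quantile hg, ← Measure.map_smul, ← sum_stratumUniform hn]
  unfold stratumIndexLaw
  rw [Measure.map_sum]
  rw [sum_stratumUniform hn]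
  exact (aemeasurable_quantile_Ioo g).smul_measure _

variable {E : Type*} [MeasurableSpace E]

/-- The laws of `(T_i, X_i)` average over the `n` strata to the law of `(T, X)` for `T` of density
`g` and `X` drawn from `κ T`. Every sum over strata of expectations of a fixed function therefore
reduces to an expectation under proposal `g` without stratification. -/
theorem sum_stratumLaw (κ : Kernel ℝ E) [IsMarkovKernel κ] {g : ℝ → ℝ} (hg : IsDensity g)
    {n : ℕ} (hn : 1 ≤ n) :
    Measure.sum (stratumLaw κ g n) = (n : ℝ≥0∞) • (densityMeasure g ⊗ₘ κ) := by
  have := hg.isProbabilityMeasure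
  rw [← Measure.compProd_smul_left, ← sum_stratumIndexLaw hg hn, Measure.compProd_sum_left]
  rfl

end

/-! ### Variances within short strata -/

section

section Average

variable {α : Type*} [MeasurableSpace α] {n : ℕ} {μ : Fin n → Measure α} {ρ : Measure α}

theorem memLp_of_sum_eq (hsum : Measure.sum μ = (n : ℝ≥0∞) • ρ) {f : α → ℝ} {p : ℝ≥0∞}
    (hf : MemLp f p ρ) (i : Fin n) : MemLp f p (μ i) :=
  hf.of_measure_le_smul (ENNReal.natCast_ne_top n) (hsum ▸ Measure.le_sum μ i)

theorem integrable_of_sum_eq (hsum : Measure.sum μ = (n : ℝ≥0∞) • ρ) {f : α → ℝ}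
    (hf : Integrable f ρ) (i : Fin n) : Integrable f (μ i) :=
  memLp_one_iff_integrable.1 (memLp_of_sum_eq hsum (memLp_one_iff_integrable.2 hf) i)

theorem integrable_average (hsum : Measure.sum μ = (n : ℝ≥0∞) • ρ) (hn : 1 ≤ n) {f : α → ℝ}
    (hf : ∀ i, Integrable f (μ i)) : Integrable f ρ := by
  have h : Integrable f ((n : ℝ≥0∞) • ρ) := by
    rw [← hsum, Measure.sum_fintype]
    exact integrable_finsetSum_measure.2 fun i _ => hf i
  exact (integrable_smul_measure (by exact_mod_cast (by omega : n ≠ 0))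
    (ENNReal.natCast_ne_top n)).1 h

theorem sum_integral_eq (hsum : Measure.sum μ = (n : ℝ≥0∞) • ρ) {f : α → ℝ}
    (hf : Integrable f ρ) : ∑ i, ∫ x, f x ∂(μ i) = n * ∫ x, f x ∂ρ := by
  rw [← integral_finsetSum_measure fun i _ => integrable_of_sum_eq hsum hf i,
    ← Measure.sum_fintype, hsum, integral_smul_measure]
  simp

end Average

/-- Stratification removes the variance due to the index: for `h` square integrable, the average
variance of `h(T_i)` over the strata vanishes in the limit. Square integrable functions of the
uniform variable are approximated by continuous ones, whose oscillation on short intervals is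
small. -/
theorem tendsto_average_variance {g : ℝ → ℝ} (hg : IsDensity g) {h : ℝ → ℝ}
    (hh : MemLp h 2 (densityMeasure g)) :
    Tendsto (fun n : ℕ => (1 / (n : ℝ)) * ∑ i : Fin n, variance h (stratumIndexLaw g n i)) atTop
      (𝓝 0) := by
  set H : ℝ → ℝ := h ∘ quantile g
  have hH : MemLp H 2 (volume.restrict (Set.Ioo (0 : ℝ) 1)) := by
    rw [← map_quantile hg] at hh
    exact hh.comp_of_map (aemeasurable_quantile_Ioo g)
  rw [Metric.tendsto_atTop]
  intro ε hε
  -- the final bound is `4 η²`, which has to be less than `ε`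
  set η : ℝ := √(ε / 5) with hη_def
  have hη : 0 < η := by positivity
  have hη2 : η ^ 2 = ε / 5 := Real.sq_sqrt (by positivity)
  obtain ⟨φ, hφc, hφH, hφ, hφL⟩ := hH.exists_hasCompactSupport_eLpNorm_sub_le (by simp)
    (ENNReal.ofReal_pos.2 hη).ne'
  have hD : MemLp (H - φ) 2 (volume.restrict (Set.Ioo (0 : ℝ) 1)) := hH.sub hφL
  have hDint : ∫ u in Set.Ioo (0 : ℝ) 1, (H u - φ u) ^ 2 ≤ η ^ 2 := by
    have h1 := hφH
    rw [hD.eLpNorm_eq_integral_rpow_norm (by simp) (by simp),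
      ENNReal.ofReal_le_ofReal_iff hη.le] at h1
    simp only [Pi.sub_apply, ENNReal.toReal_ofNat, Real.rpow_ofNat, Real.norm_eq_abs, sq_abs] at h1
    set A := ∫ u in Set.Ioo (0 : ℝ) 1, (H u - φ u) ^ 2
    have hA : 0 ≤ A := integral_nonneg fun u => sq_nonneg _
    calc A = (A ^ (2⁻¹ : ℝ)) ^ 2 := by
          rw [← Real.rpow_natCast, ← Real.rpow_mul hA]; simp
      _ ≤ η ^ 2 := by gcongr
  obtain ⟨δ, hδ, hδφ⟩ :=
    Metric.uniformContinuous_iff.1 (hφc.uniformContinuous_of_continuous hφ) η hη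
  obtain ⟨N, hN⟩ := exists_nat_one_div_lt hδ
  refine ⟨N + 1, fun n hn => ?_⟩
  have hn1 : 1 ≤ n := by omega
  have hn0 : (0 : ℝ) < n := by exact_mod_cast hn1
  have hnδ : 1 / (n : ℝ) < δ := by
    refine lt_of_le_of_lt ?_ hN
    gcongr
    exact_mod_cast hn
  have hsum := sum_stratumUniform hn1
  have hvar : ∀ i : Fin n, variance h (stratumIndexLaw g n i)
      ≤ 2 * ∫ u, (H u - φ u) ^ 2 ∂(stratumUniform n i) + 2 * η ^ 2 := by
    intro i
    have hHi : MemLp H 2 (stratumUniform n i) := memLp_of_sum_eq hsum hH i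
    have hDi : MemLp (H - φ) 2 (stratumUniform n i) := memLp_of_sum_eq hsum hD i
    have hhi : AEMeasurable h (stratumIndexLaw g n i) :=
      (memLp_of_sum_eq (sum_stratumIndexLaw hg hn1) hh i).1.aemeasurable
    -- on the `i`-th stratum `φ` differs from its value at the left end point by at most `η`
    have hosc : ∀ᵐ u ∂(stratumUniform n i), |φ u - φ ((i : ℝ) / n)| ≤ η := by
      rw [stratumUniform_eq]
      refine Measure.ae_smul_measure ?_ _
      filter_upwards [ae_restrict_mem measurableSet_Ico] with u hu
      refine (hδφ ?_).le
      rw [Real.dist_eq, abs_of_nonneg (by linarith [hu.1])]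
      have := hu.2
      rw [add_div] at this
      linarith
    rw [stratumIndexLaw, variance_map hhi (aemeasurable_quantile g n i),
      ← variance_sub_const hHi.1 (φ ((i : ℝ) / n))]
    refine (variance_le_expectation_sq (hHi.1.sub aestronglyMeasurable_const)).trans ?_
    have hDi2 : Integrable (fun u => (H u - φ u) ^ 2) (stratumUniform n i) := hDi.integrable_sq
    have hI : Integrable (fun u => 2 * (H u - φ u) ^ 2 + 2 * η ^ 2) (stratumUniform n i) :=
      (hDi2.const_mul 2).add (integrable_const _)
    calc ∫ u, ((fun u => H u - φ ((i : ℝ) / n)) ^ 2) u ∂(stratumUniform n i)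
        ≤ ∫ u, (2 * (H u - φ u) ^ 2 + 2 * η ^ 2) ∂(stratumUniform n i) := by
          refine integral_mono_of_nonneg (ae_of_all _ fun u => sq_nonneg _) hI ?_
          filter_upwards [hosc] with u hu
          have h1 : (φ u - φ ((i : ℝ) / n)) ^ 2 ≤ η ^ 2 := sq_le_sq.2 (by rwa [abs_of_pos hη])
          simp only [Pi.pow_apply]
          nlinarith [sq_nonneg ((H u - φ u) - (φ u - φ ((i : ℝ) / n)))]
      _ = _ := by
          rw [integral_add (hDi2.const_mul 2) (integrable_const _),
            integral_const_mul]
          simp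
  have hsumD := sum_integral_eq hsum hD.integrable_sq
  simp only [Pi.sub_apply] at hsumD
  have h0 : 0 ≤ (1 / (n : ℝ)) * ∑ i : Fin n, variance h (stratumIndexLaw g n i) :=
    mul_nonneg (by positivity) (Finset.sum_nonneg fun i _ => variance_nonneg _ _)
  rw [Real.dist_eq, sub_zero, abs_of_nonneg h0]
  calc (1 / (n : ℝ)) * ∑ i : Fin n, variance h (stratumIndexLaw g n i)
      ≤ (1 / (n : ℝ)) * ∑ i : Fin n,
          (2 * ∫ u, (H u - φ u) ^ 2 ∂(stratumUniform n i) + 2 * η ^ 2) := by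
        gcongr with i
        exact hvar i
    _ = 2 * (∫ u in Set.Ioo (0 : ℝ) 1, (H u - φ u) ^ 2) + 2 * η ^ 2 := by
        rw [Finset.sum_add_distrib, ← Finset.mul_sum, hsumD]
        simp
        field_simp
    _ < ε := by linarith

end

/-! ### Lindeberg's theorem -/

section

/-- The function `x² min(|x|, 1)`, which controls the second order Taylor remainder of `exp(ix)`. -/
noncomputable def lindebergFun (x : ℝ) : ℝ := x ^ 2 * min |x| 1

theorem lindebergFun_nonneg (x : ℝ) : 0 ≤ lindebergFun x :=
  mul_nonneg (sq_nonneg x) (le_min (abs_nonneg x) zero_le_one)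

theorem lindebergFun_le_sq (x : ℝ) : lindebergFun x ≤ x ^ 2 :=
  mul_le_of_le_one_right (sq_nonneg x) (min_le_right _ _)

theorem continuous_lindebergFun : Continuous lindebergFun := by
  unfold lindebergFun; fun_prop

/-- Up to constants, perturbing the argument costs no more than the square of the perturbation.
This is what allows a summand to be replaced by another one at a small distance in `L²`. -/
theorem lindebergFun_add_le (a b : ℝ) :
    lindebergFun (a + b) ≤ 8 * lindebergFun a + 4 * b ^ 2 := by
  rcases le_total |b| |a| with h | h
  · have h1 : |a + b| ≤ 2 * |a| := (abs_add_le a b).trans (by linarith)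
    have h2 : (a + b) ^ 2 ≤ 4 * a ^ 2 := by
      rw [← sq_abs (a + b), ← sq_abs a]; nlinarith [abs_nonneg (a + b)]
    have h3 : min |a + b| 1 ≤ 2 * min |a| 1 := by
      rcases le_total |a| 1 with h' | h'
      · rw [min_eq_left h']; exact (min_le_left _ _).trans h1
      · rw [min_eq_right h']; exact (min_le_right _ _).trans (by norm_num)
    have h4 : lindebergFun (a + b) ≤ (4 * a ^ 2) * (2 * min |a| 1) :=
      mul_le_mul h2 h3 (le_min (abs_nonneg _) zero_le_one) (by positivity)
    have : lindebergFun a = a ^ 2 * min |a| 1 := rfl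
    nlinarith [sq_nonneg b]
  · have h2 : (a + b) ^ 2 ≤ 4 * b ^ 2 := by
      have h1 : |a + b| ≤ 2 * |b| := (abs_add_le a b).trans (by linarith)
      rw [← sq_abs (a + b), ← sq_abs b]; nlinarith [abs_nonneg (a + b)]
    linarith [lindebergFun_le_sq (a + b), lindebergFun_nonneg a]

/-- A square is small up to a multiple of `lindebergFun`: the second term takes over when
`ε ≤ |x|`. -/
theorem sq_le_add_lindebergFun {ε : ℝ} (hε : 0 < ε) (hε1 : ε ≤ 1) (x : ℝ) :
    x ^ 2 ≤ ε ^ 2 + lindebergFun x / ε := by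
  rcases le_total |x| ε with h | h
  · have : x ^ 2 ≤ ε ^ 2 := by rw [← sq_abs x]; gcongr
    have := div_nonneg (lindebergFun_nonneg x) hε.le
    linarith
  · have h1 : x ^ 2 * ε ≤ lindebergFun x := by
      unfold lindebergFun; gcongr; exact le_min h hε1
    have h2 : x ^ 2 ≤ lindebergFun x / ε := by rwa [le_div_iff₀ hε]
    nlinarith [sq_nonneg ε]

theorem norm_cexp_sub_taylor_le (x : ℝ) :
    ‖Complex.exp (x * Complex.I) - (1 + x * Complex.I - (x : ℂ) ^ 2 / 2)‖
      ≤ 4 * lindebergFun x := by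
  rcases le_total |x| 1 with h | h
  · have hn : ‖(x : ℂ) * Complex.I‖ = |x| := by simp
    have hb := Complex.exp_bound (x := x * Complex.I) (by rwa [hn]) (n := 3) (by norm_num)
    have hs : ∑ m ∈ Finset.range 3, ((x : ℂ) * Complex.I) ^ m / m.factorial
        = 1 + x * Complex.I - (x : ℂ) ^ 2 / 2 := by
      simp [Finset.sum_range_succ, Nat.factorial, mul_pow]
      ring
    rw [hs, hn] at hb
    refine hb.trans ?_
    have : lindebergFun x = |x| ^ 3 := by
      rw [lindebergFun, min_eq_left h, ← sq_abs x]; ring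
    rw [this]
    norm_num [Nat.factorial]
    have : 0 ≤ |x| ^ 3 := by positivity
    linarith
  · have hl : lindebergFun x = |x| ^ 2 := by
      rw [lindebergFun, min_eq_right h, sq_abs, mul_one]
    calc _ ≤ ‖Complex.exp (x * Complex.I)‖ + (‖(1 : ℂ)‖ + ‖(x : ℂ) * Complex.I‖
          + ‖(x : ℂ) ^ 2 / 2‖) := by
          refine (norm_sub_le _ _).trans ?_
          gcongr
          refine (norm_sub_le _ _).trans ?_
          gcongr
          exact norm_add_le _ _
      _ = 1 + (1 + |x| + |x| ^ 2 / 2) := by simp [Complex.norm_exp_ofReal_mul_I]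
      _ ≤ 4 * lindebergFun x := by rw [hl]; nlinarith

/-- The telescoping bound for the difference of two products of numbers in the unit disc. -/
theorem norm_prod_sub_prod_le {ι : Type*} (s : Finset ι) {a b : ι → ℂ}
    (ha : ∀ i, ‖a i‖ ≤ 1) (hb : ∀ i, ‖b i‖ ≤ 1) :
    ‖∏ i ∈ s, a i - ∏ i ∈ s, b i‖ ≤ ∑ i ∈ s, ‖a i - b i‖ := by
  classical
  induction s using Finset.induction_on with
  | empty => simp
  | insert j s hj ih =>
    rw [Finset.prod_insert hj, Finset.prod_insert hj, Finset.sum_insert hj]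
    have h1 : a j * ∏ i ∈ s, a i - b j * ∏ i ∈ s, b i
        = (a j - b j) * ∏ i ∈ s, a i + b j * (∏ i ∈ s, a i - ∏ i ∈ s, b i) := by ring
    have h2 : ‖∏ i ∈ s, a i‖ ≤ 1 := by
      rw [norm_prod]; exact Finset.prod_le_one (fun _ _ => norm_nonneg _) fun i _ => ha i
    rw [h1]
    refine (norm_add_le _ _).trans ?_
    rw [norm_mul, norm_mul]
    gcongr
    · exact mul_le_of_le_one_right (norm_nonneg _) h2
    · exact (mul_le_of_le_one_left (norm_nonneg _) (hb j)).trans ih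

theorem abs_exp_neg_sub_le {x : ℝ} (hx : 0 ≤ x) : |1 - x - Real.exp (-x)| ≤ x ^ 2 := by
  rw [abs_le]
  constructor
  · rcases le_total x 1 with h | h
    · have := Real.exp_bound' (x := x) hx h (n := 1) (by norm_num)
      have h2 := Real.abs_exp_sub_one_sub_id_le (x := -x) (by rwa [abs_neg, abs_of_nonneg hx])
      rw [abs_le] at h2
      linarith [h2.2, neg_sq x]
    · have : Real.exp (-x) ≤ 1 := Real.exp_le_one_iff.2 (by linarith)
      nlinarith
  · have := Real.add_one_le_exp (-x)
    nlinarith [sq_nonneg x]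

variable {α : Type*} [MeasurableSpace α]

/-- A single characteristic function is close to that of the centred Gaussian with the same
variance. -/
theorem norm_charFun_sub_le {μ : Measure α} [IsProbabilityMeasure μ] {Z : α → ℝ}
    (hZ : MemLp Z 2 μ) (h0 : ∫ x, Z x ∂μ = 0) :
    ‖∫ x, Complex.exp (Z x * Complex.I) ∂μ - Real.exp (-((∫ x, Z x ^ 2 ∂μ) / 2))‖
      ≤ 4 * ∫ x, lindebergFun (Z x) ∂μ + ((∫ x, Z x ^ 2 ∂μ) / 2) ^ 2 := by
  have hZ1 : Integrable Z μ := hZ.integrable (by norm_num)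
  have hZ2 : Integrable (fun x => Z x ^ 2) μ := hZ.integrable_sq
  have hθ : Integrable (fun x => lindebergFun (Z x)) μ :=
    hZ2.mono' (continuous_lindebergFun.comp_aestronglyMeasurable hZ.1) (ae_of_all _ fun x => by
      rw [Real.norm_of_nonneg (lindebergFun_nonneg _)]; exact lindebergFun_le_sq _)
  have he : Integrable (fun x => Complex.exp (Z x * Complex.I)) μ := by
    refine Integrable.of_bound (C := 1) ?_ (ae_of_all _ fun x => by
      rw [Complex.norm_exp_ofReal_mul_I])
    have hexp : Continuous fun y : ℝ => Complex.exp (y * Complex.I) := by fun_prop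
    exact hexp.comp_aestronglyMeasurable hZ.1
  have hZ1c : Integrable (fun x => (Z x : ℂ) * Complex.I) μ := hZ1.ofReal.mul_const _
  have hZ2c : Integrable (fun x => (Z x : ℂ) ^ 2 / 2) μ := by
    have := (hZ2.ofReal (𝕜 := ℂ)).div_const 2
    simpa using this
  have hZ3 : Integrable (fun x => 1 + (Z x : ℂ) * Complex.I) μ := (integrable_const 1).add hZ1c
  have hZ4 : Integrable (fun x => 1 + (Z x : ℂ) * Complex.I - (Z x : ℂ) ^ 2 / 2) μ := hZ3.sub hZ2c
  have h1 : ∫ x, (1 + (Z x : ℂ) * Complex.I - (Z x : ℂ) ^ 2 / 2) ∂μ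
      = ((1 - (∫ x, Z x ^ 2 ∂μ) / 2 : ℝ) : ℂ) := by
    rw [integral_sub hZ3 hZ2c,
      integral_add (integrable_const _) hZ1c, integral_mul_const, integral_complex_ofReal, h0,
      integral_div]
    have : ∫ x, (Z x : ℂ) ^ 2 ∂μ = ((∫ x, Z x ^ 2 ∂μ : ℝ) : ℂ) := by
      rw [← integral_complex_ofReal]; simp
    rw [this]
    simp
  set σ := ∫ x, Z x ^ 2 ∂μ
  have hσ : 0 ≤ σ := integral_nonneg fun x => sq_nonneg _
  calc _ ≤ ‖∫ x, Complex.exp (Z x * Complex.I) ∂μ - ((1 - σ / 2 : ℝ) : ℂ)‖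
        + ‖((1 - σ / 2 : ℝ) : ℂ) - Real.exp (-(σ / 2))‖ := norm_sub_le_norm_sub_add_norm_sub _ _ _
    _ ≤ _ := by
      gcongr
      · rw [← h1, ← integral_sub he hZ4,
          ← integral_const_mul]
        exact norm_integral_le_of_norm_le (hθ.const_mul 4)
          (ae_of_all _ fun x => norm_cexp_sub_taylor_le (Z x))
      · rw [← Complex.ofReal_sub, Complex.norm_real, Real.norm_eq_abs]
        exact abs_exp_neg_sub_le (by positivity)

/-- **Lindeberg's theorem** for a triangular array with independent rows, in terms of
characteristic functions: the array entries `Z n i` are centred and square integrable, the row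
variances converge to `V`, and the Lindeberg quantities vanish. -/
theorem tendsto_prod_charFun {μ : (n : ℕ) → Fin n → Measure α}
    [∀ n i, IsProbabilityMeasure (μ n i)] {Z : (n : ℕ) → Fin n → α → ℝ} {V : ℝ}
    (hZ : ∀ᶠ n in atTop, ∀ i, MemLp (Z n i) 2 (μ n i) ∧ ∫ x, Z n i x ∂(μ n i) = 0)
    (hV : Tendsto (fun n => ∑ i, ∫ x, Z n i x ^ 2 ∂(μ n i)) atTop (𝓝 V))
    (hL : Tendsto (fun n => ∑ i, ∫ x, lindebergFun (Z n i x) ∂(μ n i)) atTop (𝓝 0)) :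
    Tendsto (fun n => ∏ i, ∫ x, Complex.exp (Z n i x * Complex.I) ∂(μ n i)) atTop
      (𝓝 (Real.exp (-(V / 2)) : ℂ)) := by
  set σ : (n : ℕ) → Fin n → ℝ := fun n i => ∫ x, Z n i x ^ 2 ∂(μ n i) with hσ_def
  set L : ℕ → ℝ := fun n => ∑ i, ∫ x, lindebergFun (Z n i x) ∂(μ n i) with hL_def
  have hσ : ∀ n i, 0 ≤ σ n i := fun n i => integral_nonneg fun x => sq_nonneg _
  have hLn : ∀ n i, 0 ≤ ∫ x, lindebergFun (Z n i x) ∂(μ n i) :=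
    fun n i => integral_nonneg fun x => lindebergFun_nonneg _
  -- a bound on the sum of the squared variances, for every truncation level
  have hsq : ∀ ε : ℝ, 0 < ε → ε ≤ 1 → ∀ᶠ n in atTop,
      ∑ i, (σ n i / 2) ^ 2 ≤ (∑ i, σ n i) * (ε ^ 2 + L n / ε) := by
    intro ε hε hε1
    filter_upwards [hZ] with n hn
    rw [Finset.sum_mul]
    refine Finset.sum_le_sum fun i _ => ?_
    have hZ2 : Integrable (fun x => Z n i x ^ 2) (μ n i) := (hn i).1.integrable_sq
    have hθ : Integrable (fun x => lindebergFun (Z n i x)) (μ n i) :=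
      hZ2.mono' (continuous_lindebergFun.comp_aestronglyMeasurable (hn i).1.1)
        (ae_of_all _ fun x => by
          rw [Real.norm_of_nonneg (lindebergFun_nonneg _)]; exact lindebergFun_le_sq _)
    have h1 : σ n i ≤ ε ^ 2 + (∫ x, lindebergFun (Z n i x) ∂(μ n i)) / ε := by
      calc σ n i ≤ ∫ x, (ε ^ 2 + lindebergFun (Z n i x) / ε) ∂(μ n i) :=
            integral_mono hZ2 ((integrable_const _).add (hθ.div_const _))
              fun x => sq_le_add_lindebergFun hε hε1 _
        _ = _ := by
          rw [integral_add (integrable_const _) (hθ.div_const _), integral_div]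
          simp
    have h2 : ∫ x, lindebergFun (Z n i x) ∂(μ n i) ≤ L n :=
      Finset.single_le_sum (f := fun i => ∫ x, lindebergFun (Z n i x) ∂(μ n i))
        (fun j _ => hLn n j) (Finset.mem_univ i)
    have h3 : σ n i ≤ ε ^ 2 + L n / ε := h1.trans (by gcongr)
    nlinarith [hσ n i]
  have hsq0 : Tendsto (fun n => ∑ i, (σ n i / 2) ^ 2) atTop (𝓝 0) := by
    rw [Metric.tendsto_nhds]
    intro η hη
    have hV0 : 0 ≤ V := ge_of_tendsto' hV fun n => Finset.sum_nonneg fun i _ => hσ n i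
    obtain ⟨ε, hε, hε1, hεη⟩ : ∃ ε : ℝ, 0 < ε ∧ ε ≤ 1 ∧ V * ε ^ 2 < η := by
      have : Tendsto (fun ε : ℝ => V * ε ^ 2) (𝓝[>] 0) (𝓝 0) := by
        have : Tendsto (fun ε : ℝ => V * ε ^ 2) (𝓝 0) (𝓝 (V * 0 ^ 2)) :=
          (by fun_prop : Continuous fun ε : ℝ => V * ε ^ 2).tendsto 0
        simp only [ne_eq, OfNat.ofNat_ne_zero, not_false_eq_true, zero_pow, mul_zero] at this
        exact this.mono_left nhdsWithin_le_nhds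
      obtain ⟨ε, h1, h2⟩ := ((this.eventually_lt_const hη).and
        (Ioc_mem_nhdsGT (zero_lt_one' ℝ))).exists
      exact ⟨ε, h2.1, h2.2, h1⟩
    have hlim : Tendsto (fun n => (∑ i, σ n i) * (ε ^ 2 + L n / ε)) atTop
        (𝓝 (V * (ε ^ 2 + 0 / ε))) := hV.mul (tendsto_const_nhds.add (hL.div_const ε))
    rw [zero_div, add_zero] at hlim
    filter_upwards [hsq ε hε hε1, hlim.eventually_lt_const hεη] with n h1 h2
    rw [Real.dist_eq, sub_zero, abs_of_nonneg (Finset.sum_nonneg fun i _ => sq_nonneg _)]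
    exact h1.trans_lt h2
  have hG : Tendsto (fun n => ∏ i, (Real.exp (-(σ n i / 2)) : ℂ)) atTop
      (𝓝 (Real.exp (-(V / 2)) : ℂ)) := by
    have h1 : ∀ n, ∏ i, (Real.exp (-(σ n i / 2)) : ℂ) = (Real.exp (-((∑ i, σ n i) / 2)) : ℂ) := by
      intro n
      rw [Finset.sum_div, ← Finset.sum_neg_distrib, Real.exp_sum, Complex.ofReal_prod]
    simp_rw [h1]
    exact (Complex.continuous_ofReal.tendsto _).comp ((Real.continuous_exp.tendsto _).comp
      (hV.div_const 2).neg)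
  refine (tendsto_iff_of_dist ?_).2 hG
  have hub : Tendsto (fun n => 4 * L n + ∑ i, (σ n i / 2) ^ 2) atTop (𝓝 0) := by
    simpa using (hL.const_mul 4).add hsq0
  refine tendsto_of_tendsto_of_tendsto_of_le_of_le' tendsto_const_nhds hub
    (Eventually.of_forall fun n => dist_nonneg) ?_
  filter_upwards [hZ] with n hn
  rw [dist_eq_norm]
  refine (norm_prod_sub_prod_le _ (fun i => ?_) fun i => ?_).trans ?_
  · refine (norm_integral_le_of_norm_le_const (C := 1) (ae_of_all _ fun x => by
      rw [Complex.norm_exp_ofReal_mul_I])).trans (by simp)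
  · rw [Complex.norm_real, Real.norm_of_nonneg (Real.exp_pos _).le]
    exact Real.exp_le_one_iff.2 (by linarith [hσ n i])
  · rw [hL_def, Finset.mul_sum, ← Finset.sum_add_distrib]
    exact Finset.sum_le_sum fun i _ => norm_charFun_sub_le (hn i).1 (hn i).2

end

/-! ### Law of total variance and the moments of a summand -/

section

variable {E : Type*} [MeasurableSpace E]

/-- The **law of total variance** for a pair drawn from `η ⊗ₘ κ`. -/
theorem variance_compProd {η : Measure ℝ} [IsProbabilityMeasure η] {κ : Kernel ℝ E}
    [IsMarkovKernel κ] {F : ℝ × E → ℝ} (hFm : Measurable F) (hF : MemLp F 2 (η ⊗ₘ κ)) :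
    (∀ᵐ t ∂η, MemLp (fun x => F (t, x)) 2 (κ t)) ∧
    MemLp (fun t => ∫ x, F (t, x) ∂(κ t)) 2 η ∧
    Integrable (fun t => variance (fun x => F (t, x)) (κ t)) η ∧
    variance F (η ⊗ₘ κ) = ∫ t, variance (fun x => F (t, x)) (κ t) ∂η
      + variance (fun t => ∫ x, F (t, x) ∂(κ t)) η := by
  have hF2 := hF.integrable_sq
  obtain ⟨hsec, -⟩ := (Measure.integrable_compProd_iff hF2.1).1 hF2
  have hsecL : ∀ᵐ t ∂η, MemLp (fun x => F (t, x)) 2 (κ t) := by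
    filter_upwards [hsec] with t ht
    exact (memLp_two_iff_integrable_sq
      (hFm.comp measurable_prodMk_left).aestronglyMeasurable).2 ht
  have hmean : StronglyMeasurable fun t => ∫ x, F (t, x) ∂(κ t) :=
    hFm.stronglyMeasurable.integral_kernel_prod_right'
  have hsqm : Integrable (fun t => ∫ x, F (t, x) ^ 2 ∂(κ t)) η := by
    rw [Measure.compProd] at hF2
    exact hF2.integral_compProd
  have hvar : ∀ᵐ t ∂η, variance (fun x => F (t, x)) (κ t)
      = ∫ x, F (t, x) ^ 2 ∂(κ t) - (∫ x, F (t, x) ∂(κ t)) ^ 2 := by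
    filter_upwards [hsecL] with t ht
    exact variance_eq_sub ht
  have hm2 : Integrable (fun t => (∫ x, F (t, x) ∂(κ t)) ^ 2) η := by
    refine hsqm.mono' (hmean.pow 2).aestronglyMeasurable ?_
    filter_upwards [hvar] with t ht
    rw [Real.norm_of_nonneg (sq_nonneg _)]
    linarith [variance_nonneg (fun x => F (t, x)) (κ t)]
  have hmL : MemLp (fun t => ∫ x, F (t, x) ∂(κ t)) 2 η :=
    (memLp_two_iff_integrable_sq hmean.aestronglyMeasurable).2 hm2
  refine ⟨hsecL, hmL, (hsqm.sub hm2).congr (by filter_upwards [hvar] with t ht using ht.symm), ?_⟩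
  rw [integral_congr_ae hvar, integral_sub hsqm hm2, variance_eq_sub hF, variance_eq_sub hmL]
  have h1 : ∫ p, (F ^ 2) p ∂(η ⊗ₘ κ) = ∫ t, ∫ x, F (t, x) ^ 2 ∂(κ t) ∂η :=
    Measure.integral_compProd hF2
  have h2 : ∫ p, F p ∂(η ⊗ₘ κ) = ∫ t, ∫ x, F (t, x) ∂(κ t) ∂η :=
    Measure.integral_compProd (hF.integrable (by norm_num))
  rw [h1, h2]
  simp only [Pi.pow_apply]
  ring

theorem IsDensity.measurable_ofReal {g : ℝ → ℝ} (hg : IsDensity g) :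
    Measurable fun t => ENNReal.ofReal (g t) := hg.measurable.ennreal_ofReal

theorem IsDensity.measurableSet_pos {g : ℝ → ℝ} (hg : IsDensity g) :
    MeasurableSet {t | 0 < g t} := measurableSet_lt measurable_const hg.measurable

/-- The right-hand side is restricted to `{g > 0}` so that divisions by `g` are not affected by the
convention `x / 0 = 0`. -/
theorem lintegral_densityMeasure {g : ℝ → ℝ} (hg : IsDensity g) {h : ℝ → ℝ≥0∞}
    (hh : Measurable h) :
    ∫⁻ t, h t ∂(densityMeasure g) = ∫⁻ t in {t | 0 < g t}, h t * ENNReal.ofReal (g t) := by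
  rw [densityMeasure, lintegral_withDensity_eq_lintegral_mul _ hg.measurable_ofReal hh,
    ← lintegral_indicator hg.measurableSet_pos]
  refine lintegral_congr fun t => ?_
  by_cases ht : 0 < g t
  · simp [ht, mul_comm]
  · simp [Set.indicator, ht, ENNReal.ofReal_of_nonpos (not_lt.1 ht)]

theorem integral_densityMeasure {g : ℝ → ℝ} (hg : IsDensity g) (h : ℝ → ℝ) :
    ∫ t, h t ∂(densityMeasure g) = ∫ t in {t | 0 < g t}, h t * g t := by
  rw [densityMeasure, integral_withDensity_eq_integral_toReal_smul hg.measurable_ofReal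
    (ae_of_all _ fun _ => ENNReal.ofReal_lt_top), ← integral_indicator hg.measurableSet_pos]
  refine integral_congr_ae (ae_of_all _ fun t => ?_)
  by_cases ht : 0 < g t
  · simp [ht, ht.le, mul_comm]
  · simp [Set.indicator, ht, ENNReal.ofReal_of_nonpos (not_lt.1 ht)]

theorem measurable_condMean (κ : Kernel ℝ E) [IsMarkovKernel κ] {Ψ : E → ℝ} (hΨ : Measurable Ψ) :
    Measurable (condMean κ Ψ) :=
  StronglyMeasurable.measurable <| StronglyMeasurable.integral_kernel_prod_right'
    (f := fun p : ℝ × E => Ψ p.2) (hΨ.comp measurable_snd).stronglyMeasurable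

theorem measurable_condVar (κ : Kernel ℝ E) [IsMarkovKernel κ] {Ψ : E → ℝ} (hΨ : Measurable Ψ) :
    Measurable (condVar κ Ψ) := by
  have h : Measurable fun p : ℝ × E => ‖Ψ p.2 - condMean κ Ψ p.1‖ₑ ^ 2 :=
    ((hΨ.comp measurable_snd).sub
      ((measurable_condMean κ hΨ).comp measurable_fst)).enorm.pow_const 2
  exact h.lintegral_kernel_prod_right'

/-- The summand `Ψ(X_i) w(T_i)` of the estimator, as a function of `(T_i, X_i)`. -/
noncomputable def summand (Ψ : E → ℝ) (f g : ℝ → ℝ) (p : ℝ × E) : ℝ := Ψ p.2 * weight f g p.1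

theorem measurable_weight {f g : ℝ → ℝ} (hf : IsDensity f) (hg : IsDensity g) :
    Measurable (weight f g) := hf.measurable.div hg.measurable

theorem measurable_summand {Ψ : E → ℝ} (hΨ : Measurable Ψ) {f g : ℝ → ℝ} (hf : IsDensity f)
    (hg : IsDensity g) : Measurable (summand Ψ f g) :=
  (hΨ.comp measurable_snd).mul ((measurable_weight hf hg).comp measurable_fst)

/-- Holds without integrability, since both sides are then `0`. -/
theorem integral_summand (κ : Kernel ℝ E) (Ψ : E → ℝ) (f g : ℝ → ℝ) (t : ℝ) :
    ∫ x, summand Ψ f g (t, x) ∂(κ t) = condMean κ Ψ t * weight f g t := by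
  simp only [summand, condMean, integral_mul_const]

theorem evariance_summand (κ : Kernel ℝ E) (Ψ : E → ℝ) (f g : ℝ → ℝ) (t : ℝ) :
    evariance (fun x => summand Ψ f g (t, x)) (κ t)
      = condVar κ Ψ t * ENNReal.ofReal (weight f g t ^ 2) := by
  have : (fun x => summand Ψ f g (t, x)) = fun x => weight f g t * Ψ x :=
    funext fun x => mul_comm _ _
  rw [this, evariance_mul, mul_comm, condVar]

theorem weight_sq_mul {f g : ℝ → ℝ} {t : ℝ} (ht : 0 < g t) :
    ENNReal.ofReal (weight f g t ^ 2) * ENNReal.ofReal (g t) = ENNReal.ofReal (f t ^ 2 / g t) := by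
  rw [← ENNReal.ofReal_mul (sq_nonneg _), weight]
  congr 1
  field_simp

theorem sigmaSqSSIS_eq (κ : Kernel ℝ E) [IsMarkovKernel κ] {Ψ : E → ℝ} (hΨ : Measurable Ψ)
    {f g : ℝ → ℝ} (hf : IsDensity f) (hg : IsDensity g) :
    sigmaSqSSIS κ Ψ f g
      = ∫⁻ t, condVar κ Ψ t * ENNReal.ofReal (weight f g t ^ 2) ∂(densityMeasure g) := by
  have hm : Measurable fun t => condVar κ Ψ t * ENNReal.ofReal (weight f g t ^ 2) :=
    (measurable_condVar κ hΨ).mul ((measurable_weight hf hg).pow_const 2).ennreal_ofReal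
  rw [lintegral_densityMeasure hg hm, sigmaSqSSIS]
  refine setLIntegral_congr_fun hg.measurableSet_pos fun t ht => ?_
  rw [mul_assoc, weight_sq_mul ht]

theorem weightedSecondMoment_eq (κ : Kernel ℝ E) [IsMarkovKernel κ] {Ψ : E → ℝ}
    (hΨ : Measurable Ψ) {f g : ℝ → ℝ} (hf : IsDensity f) (hg : IsDensity g) :
    weightedSecondMoment κ Ψ f g
      = ∫⁻ p, ENNReal.ofReal (summand Ψ f g p ^ 2) ∂(densityMeasure g ⊗ₘ κ) := by
  have := hg.isProbabilityMeasure
  rw [Measure.lintegral_compProd ((measurable_summand hΨ hf hg).pow_const 2).ennreal_ofReal,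
    weightedSecondMoment]
  refine lintegral_congr fun t => ?_
  rw [condSecondMoment, ← lintegral_mul_const _ (hΨ.pow_const 2).ennreal_ofReal]
  refine lintegral_congr fun x => ?_
  rw [← ENNReal.ofReal_mul (sq_nonneg _), summand, mul_pow]

/-- The moment condition says that a single unstratified summand is square integrable. -/
theorem weightedSecondMoment_ne_top_iff (κ : Kernel ℝ E) [IsMarkovKernel κ] {Ψ : E → ℝ}
    (hΨ : Measurable Ψ) {f g : ℝ → ℝ} (hf : IsDensity f) (hg : IsDensity g) :
    weightedSecondMoment κ Ψ f g ≠ ∞ ↔ MemLp (summand Ψ f g) 2 (densityMeasure g ⊗ₘ κ) := by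
  have hm := measurable_summand hΨ hf hg
  rw [memLp_two_iff_integrable_sq hm.aestronglyMeasurable, weightedSecondMoment_eq κ hΨ hf hg,
    ← lt_top_iff_ne_top, ← hasFiniteIntegral_iff_ofReal (ae_of_all _ fun p => sq_nonneg _)]
  exact ⟨fun h => ⟨(hm.pow_const 2).aestronglyMeasurable, h⟩, fun h => h.2⟩

theorem sigmaSqSSIS_eq_ofReal (κ : Kernel ℝ E) [IsMarkovKernel κ] {Ψ : E → ℝ}
    (hΨ : Measurable Ψ) {f g : ℝ → ℝ} (hf : IsDensity f) (hg : IsDensity g)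
    (h : MemLp (summand Ψ f g) 2 (densityMeasure g ⊗ₘ κ)) :
    sigmaSqSSIS κ Ψ f g = ENNReal.ofReal
      (∫ t, variance (fun x => summand Ψ f g (t, x)) (κ t) ∂(densityMeasure g)) := by
  have := hg.isProbabilityMeasure
  obtain ⟨h1, -, h3, -⟩ := variance_compProd (measurable_summand hΨ hf hg) h
  rw [ofReal_integral_eq_lintegral_ofReal h3 (ae_of_all _ fun t => variance_nonneg _ _),
    sigmaSqSSIS_eq κ hΨ hf hg]
  refine lintegral_congr_ae ?_
  filter_upwards [h1] with t ht
  rw [ofReal_variance ht, evariance_summand]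

end

/-! ### Mean, variance and asymptotic normality of the estimator -/

section

theorem estimator_eq {E : Type*} (Ψ : E → ℝ) (f g : ℝ → ℝ) (n : ℕ) :
    estimator Ψ f g n = fun s => (1 / (n : ℝ)) * (∑ i, fun s : Fin n → ℝ × E =>
      summand Ψ f g (s i)) s := by
  funext s
  simp [estimator, summand]

variable {E : Type*} [MeasurableSpace E]

/-- Importance sampling never destroys integrability: weighting by `f / g` under `g` amounts to
restricting the original law to `{g > 0}`. -/
theorem integrable_summand {κ : Kernel ℝ E} [IsMarkovKernel κ] {Ψ : E → ℝ} (hΨ : Measurable Ψ)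
    {f g : ℝ → ℝ} (hf : IsDensity f) (hg : IsDensity g)
    (hint : Integrable (fun p : ℝ × E => Ψ p.2) (densityMeasure f ⊗ₘ κ)) :
    Integrable (summand Ψ f g) (densityMeasure g ⊗ₘ κ) := by
  have := hg.isProbabilityMeasure
  have := hf.isProbabilityMeasure
  have hm := measurable_summand hΨ hf hg
  refine ⟨hm.aestronglyMeasurable, ?_⟩
  have hN : Measurable fun t => ∫⁻ x, ‖Ψ x‖ₑ ∂(κ t) :=
    Measurable.lintegral_kernel_prod_right' (f := fun p : ℝ × E => ‖Ψ p.2‖ₑ)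
      (hΨ.comp measurable_snd).enorm
  have h1 : ∀ t, ∫⁻ x, ‖summand Ψ f g (t, x)‖ₑ ∂(κ t)
      = (∫⁻ x, ‖Ψ x‖ₑ ∂(κ t)) * ‖weight f g t‖ₑ := fun t => by
    simp only [summand, enorm_mul]
    exact lintegral_mul_const _ hΨ.enorm
  have h2 : Measurable fun t => (∫⁻ x, ‖Ψ x‖ₑ ∂(κ t)) * ‖weight f g t‖ₑ :=
    hN.mul (measurable_weight hf hg).enorm
  have h3 := hint.2
  have hΨ2 : Measurable fun p : ℝ × E => ‖Ψ p.2‖ₑ := (hΨ.comp measurable_snd).enorm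
  rw [HasFiniteIntegral, Measure.lintegral_compProd hΨ2, lintegral_densityMeasure hf hN] at h3
  rw [HasFiniteIntegral, Measure.lintegral_compProd hm.enorm]
  simp_rw [h1]
  rw [lintegral_densityMeasure hg h2]
  refine lt_of_le_of_lt ?_ h3
  calc ∫⁻ t in {t | 0 < g t}, (∫⁻ x, ‖Ψ x‖ₑ ∂(κ t)) * ‖weight f g t‖ₑ * ENNReal.ofReal (g t)
      = ∫⁻ t in {t | 0 < g t}, (∫⁻ x, ‖Ψ x‖ₑ ∂(κ t)) * ENNReal.ofReal (f t) := by
        refine setLIntegral_congr_fun hg.measurableSet_pos fun t ht => ?_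
        have hgt : g t ≠ 0 := (show 0 < g t from ht).ne'
        rw [mul_assoc, weight, Real.enorm_eq_ofReal (div_nonneg (hf.nonneg t) (hg.nonneg t)),
          ← ENNReal.ofReal_mul (div_nonneg (hf.nonneg t) (hg.nonneg t)), div_mul_cancel₀ _ hgt]
    _ ≤ ∫⁻ t, (∫⁻ x, ‖Ψ x‖ₑ ∂(κ t)) * ENNReal.ofReal (f t) := setLIntegral_le_lintegral _ _
    _ = ∫⁻ t in {t | 0 < f t}, (∫⁻ x, ‖Ψ x‖ₑ ∂(κ t)) * ENNReal.ofReal (f t) := by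
        rw [← lintegral_indicator hf.measurableSet_pos]
        refine lintegral_congr fun t => ?_
        by_cases ht : 0 < f t
        · simp [ht]
        · simp [Set.indicator, ht, ENNReal.ofReal_of_nonpos (not_lt.1 ht)]

theorem integral_summand_compProd {κ : Kernel ℝ E} [IsMarkovKernel κ] {Ψ : E → ℝ}
    {f g : ℝ → ℝ} (hg : IsDensity g)
    (h : Integrable (summand Ψ f g) (densityMeasure g ⊗ₘ κ)) :
    ∫ p, summand Ψ f g p ∂(densityMeasure g ⊗ₘ κ) = muSIS κ Ψ f g := by
  have := hg.isProbabilityMeasure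
  rw [Measure.integral_compProd h]
  simp_rw [integral_summand]
  rw [integral_densityMeasure hg, muSIS]
  refine setIntegral_congr_fun hg.measurableSet_pos fun t ht => ?_
  have hgt : g t ≠ 0 := (show 0 < g t from ht).ne'
  simp only [weight]
  field_simp

theorem integrable_estimator {κ : Kernel ℝ E} [IsMarkovKernel κ] {Ψ : E → ℝ} {f g : ℝ → ℝ}
    (hg : IsDensity g) (h : Integrable (summand Ψ f g) (densityMeasure g ⊗ₘ κ)) {n : ℕ}
    (hn : 1 ≤ n) : Integrable (estimator Ψ f g n) (sampleLaw κ g n) := by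
  have h1 : ∀ i, Integrable (fun s => summand Ψ f g (s i)) (sampleLaw κ g n) :=
    fun i => integrable_comp_eval (integrable_of_sum_eq (sum_stratumLaw κ hg hn) h i)
  exact (integrable_finsetSum _ fun i _ => h1 i).const_mul _

theorem sum_integral_summand {κ : Kernel ℝ E} [IsMarkovKernel κ] {Ψ : E → ℝ} {f g : ℝ → ℝ}
    (hg : IsDensity g) (h : Integrable (summand Ψ f g) (densityMeasure g ⊗ₘ κ)) {n : ℕ}
    (hn : 1 ≤ n) : ∑ i, ∫ p, summand Ψ f g p ∂(stratumLaw κ g n i) = n * muSIS κ Ψ f g := by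
  rw [sum_integral_eq (sum_stratumLaw κ hg hn) h, integral_summand_compProd hg h]

theorem integral_estimator {κ : Kernel ℝ E} [IsMarkovKernel κ] {Ψ : E → ℝ} {f g : ℝ → ℝ}
    (hg : IsDensity g) (h : Integrable (summand Ψ f g) (densityMeasure g ⊗ₘ κ)) {n : ℕ}
    (hn : 1 ≤ n) : ∫ s, estimator Ψ f g n s ∂(sampleLaw κ g n) = muSIS κ Ψ f g := by
  have hi := integrable_of_sum_eq (sum_stratumLaw κ hg hn) h
  have h1 : ∫ s, estimator Ψ f g n s ∂(sampleLaw κ g n)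
      = (1 / (n : ℝ)) * ∑ i, ∫ p, summand Ψ f g p ∂(stratumLaw κ g n i) := by
    have h2 : ∀ i, ∫ p, summand Ψ f g p ∂(stratumLaw κ g n i)
        = ∫ s, summand Ψ f g (s i) ∂(sampleLaw κ g n) :=
      fun i => (integral_comp_eval (hi i).1).symm
    simp_rw [h2]
    have h3 : ∀ i, Integrable (fun s => summand Ψ f g (s i)) (sampleLaw κ g n) :=
      fun i => integrable_comp_eval (hi i)
    rw [← integral_finsetSum _ fun i _ => h3 i, ← integral_const_mul]
    rfl
  rw [h1, sum_integral_summand hg h hn]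
  have : (n : ℝ) ≠ 0 := by positivity
  field_simp

theorem memLp_estimator {κ : Kernel ℝ E} [IsMarkovKernel κ] {Ψ : E → ℝ} {f g : ℝ → ℝ}
    (hg : IsDensity g) (h : MemLp (summand Ψ f g) 2 (densityMeasure g ⊗ₘ κ)) {n : ℕ}
    (hn : 1 ≤ n) : MemLp (estimator Ψ f g n) 2 (sampleLaw κ g n) :=
  (memLp_finsetSum _ fun i _ =>
    (memLp_of_sum_eq (sum_stratumLaw κ hg hn) h i).comp_measurePreserving
      (measurePreserving_eval (stratumLaw κ g n) i)).const_mul _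

theorem variance_estimator {κ : Kernel ℝ E} [IsMarkovKernel κ] {Ψ : E → ℝ} {f g : ℝ → ℝ}
    (hg : IsDensity g) (h : MemLp (summand Ψ f g) 2 (densityMeasure g ⊗ₘ κ)) {n : ℕ}
    (hn : 1 ≤ n) : variance (estimator Ψ f g n) (sampleLaw κ g n)
      = (1 / (n : ℝ)) ^ 2 * ∑ i, variance (summand Ψ f g) (stratumLaw κ g n i) := by
  rw [estimator_eq, variance_const_mul, sampleLaw,
    variance_sum_pi (memLp_of_sum_eq (sum_stratumLaw κ hg hn) h)]

/-- The law of total variance applied in every stratum: the conditional variances add up to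
`σ²_SSIS` exactly, and the excess is the average variance of the conditional mean over the
strata. -/
theorem mul_variance_estimator {κ : Kernel ℝ E} [IsMarkovKernel κ] {Ψ : E → ℝ}
    (hΨ : Measurable Ψ) {f g : ℝ → ℝ} (hf : IsDensity f) (hg : IsDensity g)
    (h : MemLp (summand Ψ f g) 2 (densityMeasure g ⊗ₘ κ)) {n : ℕ} (hn : 1 ≤ n) :
    n * variance (estimator Ψ f g n) (sampleLaw κ g n) = (sigmaSqSSIS κ Ψ f g).toReal
      + (1 / (n : ℝ)) * ∑ i : Fin n,
        variance (fun t => condMean κ Ψ t * weight f g t) (stratumIndexLaw g n i) := by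
  have := hg.isProbabilityMeasure
  have hm := measurable_summand hΨ hf hg
  have hi := memLp_of_sum_eq (sum_stratumLaw κ hg hn) h
  have h1 : ∀ i, variance (summand Ψ f g) (stratumLaw κ g n i)
      = ∫ t, variance (fun x => summand Ψ f g (t, x)) (κ t) ∂(stratumIndexLaw g n i)
        + variance (fun t => condMean κ Ψ t * weight f g t) (stratumIndexLaw g n i) := by
    intro i
    have := (variance_compProd (η := stratumIndexLaw g n i) hm (hi i)).2.2.2
    simp_rw [integral_summand] at this
    exact this
  have h2 := (variance_compProd hm h).2.2.1
  rw [variance_estimator hg h hn, sigmaSqSSIS_eq_ofReal κ hΨ hf hg h,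
    ENNReal.toReal_ofReal (integral_nonneg fun t => variance_nonneg _ _)]
  simp_rw [h1]
  rw [Finset.sum_add_distrib, sum_integral_eq (sum_stratumIndexLaw hg hn) h2]
  have : (n : ℝ) ≠ 0 := by positivity
  field_simp

theorem memLp_condMean_mul_weight {κ : Kernel ℝ E} [IsMarkovKernel κ] {Ψ : E → ℝ}
    (hΨ : Measurable Ψ) {f g : ℝ → ℝ} (hf : IsDensity f) (hg : IsDensity g)
    (h : MemLp (summand Ψ f g) 2 (densityMeasure g ⊗ₘ κ)) :
    MemLp (fun t => condMean κ Ψ t * weight f g t) 2 (densityMeasure g) := by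
  have := hg.isProbabilityMeasure
  have := (variance_compProd (measurable_summand hΨ hf hg) h).2.1
  simpa only [integral_summand] using this

theorem tendsto_mul_variance_estimator {κ : Kernel ℝ E} [IsMarkovKernel κ] {Ψ : E → ℝ}
    (hΨ : Measurable Ψ) {f g : ℝ → ℝ} (hf : IsDensity f) (hg : IsDensity g)
    (h : MemLp (summand Ψ f g) 2 (densityMeasure g ⊗ₘ κ)) :
    Tendsto (fun n : ℕ => n * variance (estimator Ψ f g n) (sampleLaw κ g n)) atTop
      (𝓝 (sigmaSqSSIS κ Ψ f g).toReal) := by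
  have h1 := (tendsto_average_variance hg (memLp_condMean_mul_weight hΨ hf hg h)).const_add
    (sigmaSqSSIS κ Ψ f g).toReal
  rw [add_zero] at h1
  refine h1.congr' ?_
  filter_upwards [eventually_ge_atTop 1] with n hn
  rw [mul_variance_estimator hΨ hf hg h hn]

theorem isLittleO_variance_estimator {κ : Kernel ℝ E} [IsMarkovKernel κ] {Ψ : E → ℝ}
    (hΨ : Measurable Ψ) {f g : ℝ → ℝ} (hf : IsDensity f) (hg : IsDensity g)
    (h : MemLp (summand Ψ f g) 2 (densityMeasure g ⊗ₘ κ)) :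
    (fun n : ℕ => variance (estimator Ψ f g n) (sampleLaw κ g n)
      - (sigmaSqSSIS κ Ψ f g).toReal / n) =o[atTop] (fun n : ℕ => 1 / (n : ℝ)) := by
  refine (isLittleO_iff_tendsto' ?_).2 ?_
  · filter_upwards [eventually_ge_atTop 1] with n hn h0
    have : (n : ℝ) ≠ 0 := by positivity
    simp [this] at h0
  · have h1 := (tendsto_mul_variance_estimator hΨ hf hg h).sub_const (sigmaSqSSIS κ Ψ f g).toReal
    rw [sub_self] at h1
    refine h1.congr' ?_
    filter_upwards [eventually_ge_atTop 1] with n hn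
    have : (n : ℝ) ≠ 0 := by positivity
    field_simp

theorem measurePreserving_fst_compProd (η : Measure ℝ) [IsProbabilityMeasure η] (κ : Kernel ℝ E)
    [IsMarkovKernel κ] : MeasurePreserving Prod.fst (η ⊗ₘ κ) η :=
  ⟨measurable_fst, Measure.fst_compProd η κ⟩

/-- The Lindeberg condition, for the standardized entries `(t/√n) (Ψ(X_i) w(T_i) - E)`. Each entry
splits into the deviation from the conditional mean, whose truncated moments add up to a truncated
moment under the unstratified law, and the centred conditional mean, whose variances are
negligible on average. -/
theorem tendsto_sum_lindebergFun {κ : Kernel ℝ E} [IsMarkovKernel κ] {Ψ : E → ℝ}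
    (hΨ : Measurable Ψ) {f g : ℝ → ℝ} (hf : IsDensity f) (hg : IsDensity g)
    (h : MemLp (summand Ψ f g) 2 (densityMeasure g ⊗ₘ κ)) (t : ℝ) :
    Tendsto (fun n : ℕ => ∑ i : Fin n, ∫ p, lindebergFun (t / √(n : ℝ) *
      (summand Ψ f g p - ∫ q, summand Ψ f g q ∂(stratumLaw κ g n i))) ∂(stratumLaw κ g n i))
      atTop (𝓝 0) := by
  have := hg.isProbabilityMeasure
  set m : ℝ → ℝ := fun s => condMean κ Ψ s * weight f g s with hm_def
  have hmL : MemLp m 2 (densityMeasure g) := memLp_condMean_mul_weight hΨ hf hg h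
  have hmρ : MemLp (fun p : ℝ × E => m p.1) 2 (densityMeasure g ⊗ₘ κ) :=
    hmL.comp_measurePreserving (measurePreserving_fst_compProd _ κ)
  set A : ℝ × E → ℝ := fun p => summand Ψ f g p - m p.1 with hA_def
  have hA : MemLp A 2 (densityMeasure g ⊗ₘ κ) := h.sub hmρ
  have hθ : ∀ n : ℕ, Integrable (fun p => lindebergFun (t / √(n : ℝ) * A p))
      (densityMeasure g ⊗ₘ κ) := fun n =>
    ((hA.const_mul (t / √(n : ℝ))).integrable_sq).mono'
      (continuous_lindebergFun.comp_aestronglyMeasurable (hA.1.const_mul _))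
      (ae_of_all _ fun p => by
        rw [Real.norm_of_nonneg (lindebergFun_nonneg _)]; exact lindebergFun_le_sq _)
  -- the summed truncated moments of `A` are `n` times a moment under the unstratified law; the
  -- integrand is dominated by `t² A²` and tends to `0` pointwise
  have hdom : Tendsto (fun n : ℕ => ∫ p, n * lindebergFun (t / √(n : ℝ) * A p)
      ∂(densityMeasure g ⊗ₘ κ)) atTop (𝓝 0) := by
    have hform : ∀ n : ℕ, 1 ≤ n → ∀ a : ℝ, n * lindebergFun (t / √(n : ℝ) * a)
        = t ^ 2 * a ^ 2 * min |t / √(n : ℝ) * a| 1 := by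
      intro n hn a
      have hn0 : (0 : ℝ) < n := by positivity
      rw [lindebergFun, mul_pow, div_pow, Real.sq_sqrt hn0.le]
      field_simp
    have h0 : ∫ _ : ℝ × E, (0 : ℝ) ∂(densityMeasure g ⊗ₘ κ) = 0 := integral_zero _ _
    rw [← h0]
    refine tendsto_integral_filter_of_dominated_convergence (fun p => t ^ 2 * A p ^ 2)
      (Eventually.of_forall fun n => (hθ n).1.const_mul _) ?_
      (hA.integrable_sq.const_mul _) (ae_of_all _ fun p => ?_)
    · filter_upwards [eventually_ge_atTop 1] with n hn
      refine ae_of_all _ fun p => ?_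
      rw [hform n hn, Real.norm_of_nonneg (by positivity)]
      exact mul_le_of_le_one_right (by positivity) (min_le_right _ _)
    · have h1 : Tendsto (fun n : ℕ => t / √(n : ℝ) * A p) atTop (𝓝 (0 * A p)) :=
        (tendsto_const_nhds.div_atTop
          (Real.tendsto_sqrt_atTop.comp tendsto_natCast_atTop_atTop)).mul_const _
      have h2 := (((h1.abs).min (tendsto_const_nhds (x := (1 : ℝ)))).const_mul
        (t ^ 2 * A p ^ 2))
      simp only [zero_mul, abs_zero, zero_le_one, min_eq_left, mul_zero] at h2
      refine h2.congr' ?_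
      filter_upwards [eventually_ge_atTop 1] with n hn
      rw [hform n hn]
  have hlim := (hdom.const_mul 8).add ((tendsto_average_variance hg hmL).const_mul (4 * t ^ 2))
  simp only [mul_zero, add_zero] at hlim
  refine tendsto_of_tendsto_of_tendsto_of_le_of_le' tendsto_const_nhds hlim
    (Eventually.of_forall fun n => Finset.sum_nonneg fun i _ =>
      integral_nonneg fun p => lindebergFun_nonneg _) ?_
  filter_upwards [eventually_ge_atTop 1] with n hn
  have hn0 : (0 : ℝ) < n := by positivity
  have hsum := sum_stratumLaw κ hg hn
  rw [integral_const_mul, ← sum_integral_eq hsum (hθ n), Finset.mul_sum, Finset.mul_sum,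
    Finset.mul_sum, ← Finset.sum_add_distrib]
  refine Finset.sum_le_sum fun i _ => ?_
  have hpres : MeasurePreserving Prod.fst (stratumLaw κ g n i) (stratumIndexLaw g n i) :=
    measurePreserving_fst_compProd (stratumIndexLaw g n i) κ
  have hmi : MemLp m 2 (stratumIndexLaw g n i) := memLp_of_sum_eq (sum_stratumIndexLaw hg hn) hmL i
  have hFi : MemLp (summand Ψ f g) 2 (stratumLaw κ g n i) := memLp_of_sum_eq hsum h i
  have hmean : ∫ q, summand Ψ f g q ∂(stratumLaw κ g n i) = ∫ s, m s ∂(stratumIndexLaw g n i) := by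
    have h1 := Measure.integral_compProd (μ := stratumIndexLaw g n i) (κ := κ)
      (hFi.integrable (by norm_num))
    simp_rw [integral_summand] at h1
    exact h1
  rw [hmean]
  set e := ∫ s, m s ∂(stratumIndexLaw g n i)
  have hB : MemLp (fun s => m s - e) 2 (stratumIndexLaw g n i) := hmi.sub (memLp_const e)
  have hB2 : Integrable (fun p : ℝ × E => (m p.1 - e) ^ 2) (stratumLaw κ g n i) :=
    (hB.comp_measurePreserving hpres).integrable_sq
  have hvar : ∫ p : ℝ × E, (m p.1 - e) ^ 2 ∂(stratumLaw κ g n i)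
      = variance m (stratumIndexLaw g n i) := by
    rw [variance_eq_integral hmi.1.aemeasurable]
    change _ = ∫ s, (m s - e) ^ 2 ∂(stratumIndexLaw g n i)
    rw [← hpres.map_eq,
      integral_map hpres.aemeasurable (by rw [hpres.map_eq]; exact hB.integrable_sq.1)]
  have hθi : Integrable (fun p => lindebergFun (t / √(n : ℝ) * A p)) (stratumLaw κ g n i) :=
    integrable_of_sum_eq hsum (hθ n) i
  calc _ ≤ ∫ p, (8 * lindebergFun (t / √(n : ℝ) * A p)
        + 4 * (t / √(n : ℝ)) ^ 2 * (m p.1 - e) ^ 2) ∂(stratumLaw κ g n i) := by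
        refine integral_mono_of_nonneg (ae_of_all _ fun p => lindebergFun_nonneg _)
          ((hθi.const_mul 8).add (hB2.const_mul _)) (ae_of_all _ fun p => ?_)
        have h1 : t / √(n : ℝ) * (summand Ψ f g p - e)
            = t / √(n : ℝ) * A p + t / √(n : ℝ) * (m p.1 - e) := by simp only [hA_def]; ring
        have h2 := lindebergFun_add_le (t / √(n : ℝ) * A p) (t / √(n : ℝ) * (m p.1 - e))
        simp only [h1]
        rw [mul_pow (t / √(n : ℝ)) (m p.1 - e), ← mul_assoc] at h2
        exact h2
    _ = _ := by
        rw [integral_add (hθi.const_mul 8) (hB2.const_mul _), integral_const_mul,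
          integral_const_mul, hvar, div_pow, Real.sq_sqrt hn0.le]
        ring

/-- Asymptotic normality of the stratified estimator. The standardized estimator is a sum of
independent centred entries, to which Lindeberg's theorem applies; convergence in distribution
follows from that of the characteristic functions. -/
theorem tendstoInDistribution_estimator {κ : Kernel ℝ E} [IsMarkovKernel κ] {Ψ : E → ℝ}
    (hΨ : Measurable Ψ) {f g : ℝ → ℝ} (hf : IsDensity f) (hg : IsDensity g)
    (h : MemLp (summand Ψ f g) 2 (densityMeasure g ⊗ₘ κ)) :
    TendstoInDistribution
      (fun (n : ℕ) s => √(n : ℝ) * (estimator Ψ f g n s - muSIS κ Ψ f g))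
      atTop (id : ℝ → ℝ) (fun n => sampleLaw κ g n)
      (gaussianReal 0 (sigmaSqSSIS κ Ψ f g).toNNReal) := by
  have := hg.isProbabilityMeasure
  have hest : ∀ n, Measurable (estimator Ψ f g n) := fun n =>
    (Finset.measurable_sum _ fun i _ =>
      (measurable_summand hΨ hf hg).comp (measurable_pi_apply i)).const_mul _
  have hmeas : ∀ n : ℕ, Measurable
      (fun s => √(n : ℝ) * (estimator Ψ f g n s - muSIS κ Ψ f g)) := fun n =>
    ((hest n).sub_const _).const_mul _
  refine ⟨fun n => (hmeas n).aemeasurable, aemeasurable_id, ?_⟩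
  refine ProbabilityMeasure.tendsto_iff_tendsto_charFun.2 fun t => ?_
  simp only [ProbabilityMeasure.coe_mk, Measure.map_id, charFun_gaussianReal]
  set σ := (sigmaSqSSIS κ Ψ f g).toReal with hσ
  have hρ1 : Integrable (summand Ψ f g) (densityMeasure g ⊗ₘ κ) := h.integrable (by norm_num)
  have key := tendsto_prod_charFun (μ := fun n i => stratumLaw κ g n i)
    (Z := fun n i p => t / √(n : ℝ) *
      (summand Ψ f g p - ∫ q, summand Ψ f g q ∂(stratumLaw κ g n i))) (V := t ^ 2 * σ)
    ?_ ?_ (tendsto_sum_lindebergFun hΨ hf hg h t)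
  · have hlim : (Real.exp (-(t ^ 2 * σ / 2)) : ℂ)
        = Complex.exp (t * ((0 : ℝ) : ℂ) * Complex.I
          - (((sigmaSqSSIS κ Ψ f g).toNNReal : ℝ) : ℂ) * t ^ 2 / 2) := by
      have : (((sigmaSqSSIS κ Ψ f g).toNNReal : ℝ)) = σ := rfl
      rw [this]
      push_cast
      congr 1
      ring
    rw [hlim] at key
    refine key.congr' ?_
    filter_upwards [eventually_ge_atTop 1] with n hn
    have hn0 : (0 : ℝ) < n := by positivity
    rw [charFun_apply_real, integral_map (hmeas n).aemeasurable
      (by fun_prop : Continuous fun x : ℝ => Complex.exp (t * x * Complex.I)).aestronglyMeasurable,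
      sampleLaw, ← integral_fintype_prod_eq_prod (fun i p => Complex.exp
        (((t / √(n : ℝ) * (summand Ψ f g p - ∫ q, summand Ψ f g q ∂(stratumLaw κ g n i)) : ℝ) : ℂ)
          * Complex.I))]
    refine integral_congr_ae (ae_of_all _ fun s => ?_)
    simp only
    rw [← Complex.exp_sum, ← Finset.sum_mul, ← Complex.ofReal_sum, ← Finset.mul_sum,
      Finset.sum_sub_distrib, sum_integral_summand hg hρ1 hn, ← Complex.ofReal_mul]
    congr 3
    have hs : √(n : ℝ) ^ 2 = n := Real.sq_sqrt hn0.le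
    have hs0 : √(n : ℝ) ≠ 0 := (Real.sqrt_pos.2 hn0).ne'
    simp only [estimator, summand]
    field_simp
    rw [hs]
  · filter_upwards [eventually_ge_atTop 1] with n hn i
    have hFi := memLp_of_sum_eq (sum_stratumLaw κ hg hn) h i
    refine ⟨(hFi.sub (memLp_const _)).const_mul _, ?_⟩
    rw [integral_const_mul, integral_sub (hFi.integrable (by norm_num)) (integrable_const _)]
    simp
  · refine ((tendsto_mul_variance_estimator hΨ hf hg h).const_mul (t ^ 2)).congr' ?_
    filter_upwards [eventually_ge_atTop 1] with n hn
    have hn0 : (0 : ℝ) < n := by positivity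
    have h1 : ∀ i : Fin n, ∫ p, (t / √(n : ℝ) *
        (summand Ψ f g p - ∫ q, summand Ψ f g q ∂(stratumLaw κ g n i))) ^ 2 ∂(stratumLaw κ g n i)
        = t ^ 2 / n * variance (summand Ψ f g) (stratumLaw κ g n i) := fun i => by
      rw [variance_eq_integral (measurable_summand hΨ hf hg).aemeasurable, ← integral_const_mul]
      simp_rw [mul_pow, div_pow, Real.sq_sqrt hn0.le]
    simp_rw [h1]
    rw [variance_estimator hg h hn, ← Finset.mul_sum]
    field_simp

end

/-! ### The variance functional and its minimizer -/

section

/-- If a sum of independent variables is square integrable, so is each summand: conditionally on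
the other summands, it differs from the sum by a constant. -/
theorem memLp_of_memLp_sum_pi {ι α : Type*} [Fintype ι] [MeasurableSpace α] {μ : ι → Measure α}
    [∀ i, IsProbabilityMeasure (μ i)] {Y : ι → α → ℝ} (hY : ∀ i, Measurable (Y i))
    (h : MemLp (fun s => ∑ i, Y i (s i)) 2 (Measure.pi μ)) (j : ι) : MemLp (Y j) 2 (μ j) := by
  classical
  set Z : ι → (ι → α) → ℝ := fun i s => Y i (s i) with hZ_def
  have hZ : ∀ i, Measurable (Z i) := fun i => (hY i).comp (measurable_pi_apply i)
  have hind : iIndepFun Z (Measure.pi μ) := iIndepFun_pi fun i => (hY i).aemeasurable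
  set S : (ι → α) → ℝ := ∑ i ∈ Finset.univ.erase j, Z i with hS_def
  have hS : Measurable S := by
    rw [show S = fun s => ∑ i ∈ Finset.univ.erase j, Z i s from funext fun s => by simp [hS_def]]
    exact Finset.measurable_sum _ fun i _ => hZ i
  have hSj : IndepFun S (Z j) (Measure.pi μ) :=
    hind.indepFun_finsetSum_of_notMem hZ (Finset.notMem_erase j _)
  have hlaw := (indepFun_iff_map_prod_eq_prod_map_map hS.aemeasurable (hZ j).aemeasurable).1 hSj
  have hsum : (fun s => ∑ i, Y i (s i)) = fun s => S s + Z j s := by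
    funext s
    rw [hS_def, Finset.sum_apply, ← Finset.sum_erase_add _ _ (Finset.mem_univ j)]
  rw [hsum] at h
  have := Measure.isProbabilityMeasure_map (μ := Measure.pi μ) hS.aemeasurable
  have := Measure.isProbabilityMeasure_map (μ := Measure.pi μ) (hZ j).aemeasurable
  have hadd : Measurable fun q : ℝ × ℝ => q.1 + q.2 := measurable_fst.add measurable_snd
  have h1 : MemLp (fun q : ℝ × ℝ => q.1 + q.2) 2
      (((Measure.pi μ).map S).prod ((Measure.pi μ).map (Z j))) := by
    rw [← hlaw, memLp_map_measure_iff hadd.aestronglyMeasurable (hS.prodMk (hZ j)).aemeasurable]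
    exact h
  -- by Fubini, `a + Z j` is square integrable for almost every value `a` of the other summands
  obtain ⟨a, ha⟩ := h1.integrable_sq.prod_right_ae.exists
  have h2 : MemLp (fun y : ℝ => a + y) 2 ((Measure.pi μ).map (Z j)) :=
    (memLp_two_iff_integrable_sq (measurable_const_add a).aestronglyMeasurable).2 ha
  have h3 : MemLp (fun y : ℝ => y) 2 ((Measure.pi μ).map (Z j)) := by
    refine (memLp_congr_ae (ae_of_all _ fun y => ?_)).1 (h2.sub (memLp_const a))
    simp
  have h4 : MemLp (Z j) 2 (Measure.pi μ) := h3.comp_of_map (hZ j).aemeasurable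
  have hp := measurePreserving_eval μ j
  rw [← hp.map_eq, memLp_map_measure_iff (hY j).aestronglyMeasurable hp.aemeasurable]
  exact h4

variable {E : Type*} [MeasurableSpace E]

/-- Conversely to `memLp_estimator`: if the estimator is square integrable for one sample size, the
moment condition holds. -/
theorem memLp_summand_of_memLp_estimator {κ : Kernel ℝ E} [IsMarkovKernel κ] {Ψ : E → ℝ}
    (hΨ : Measurable Ψ) {f g : ℝ → ℝ} (hf : IsDensity f) (hg : IsDensity g) {n : ℕ} (hn : 1 ≤ n)
    (h : MemLp (estimator Ψ f g n) 2 (sampleLaw κ g n)) :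
    MemLp (summand Ψ f g) 2 (densityMeasure g ⊗ₘ κ) := by
  have hm := measurable_summand hΨ hf hg
  have hn0 : (n : ℝ) ≠ 0 := by positivity
  have h1 : MemLp (fun s => ∑ i, summand Ψ f g (s i)) 2 (sampleLaw κ g n) := by
    have h2 := h.const_mul (n : ℝ)
    refine (memLp_congr_ae (ae_of_all _ fun s => ?_)).1 h2
    simp only [estimator, summand]
    field_simp
  rw [memLp_two_iff_integrable_sq hm.aestronglyMeasurable]
  exact integrable_average (sum_stratumLaw κ hg hn) hn fun i =>
    (memLp_of_memLp_sum_pi (fun _ => hm) h1 i).integrable_sq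

/-- The function `v f`, of which the optimal proposal is the normalization. Where `v` is infinite
the value is `0`. -/
noncomputable def sdMulDensity (κ : Kernel ℝ E) (Ψ : E → ℝ) (f : ℝ → ℝ) (t : ℝ) : ℝ :=
  (condSD κ Ψ t).toReal * f t

theorem optDensity_eq (κ : Kernel ℝ E) (Ψ : E → ℝ) (f : ℝ → ℝ) (t : ℝ) :
    optDensity κ Ψ f t = (optConst κ Ψ f).toReal⁻¹ * sdMulDensity κ Ψ f t :=
  mul_assoc _ _ _

theorem measurable_condSD (κ : Kernel ℝ E) [IsMarkovKernel κ] {Ψ : E → ℝ} (hΨ : Measurable Ψ) :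
    Measurable (condSD κ Ψ) := (measurable_condVar κ hΨ).pow_const _

theorem condSD_sq (κ : Kernel ℝ E) (Ψ : E → ℝ) (t : ℝ) : condSD κ Ψ t ^ 2 = condVar κ Ψ t := by
  rw [condSD, ← ENNReal.rpow_natCast, ← ENNReal.rpow_mul]
  norm_num

theorem condSD_eq_zero_iff (κ : Kernel ℝ E) (Ψ : E → ℝ) (t : ℝ) :
    condSD κ Ψ t = 0 ↔ condVar κ Ψ t = 0 := by
  rw [← condSD_sq]; simp

section Optimal

variable {κ : Kernel ℝ E} {Ψ : E → ℝ} {f g : ℝ → ℝ}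

theorem sdMulDensity_nonneg (hf : IsDensity f) (t : ℝ) : 0 ≤ sdMulDensity κ Ψ f t :=
  mul_nonneg ENNReal.toReal_nonneg (hf.nonneg t)

theorem optDensity_pos_iff (h0 : optConst κ Ψ f ≠ 0) (hc : optConst κ Ψ f ≠ ∞) (t : ℝ) :
    0 < optDensity κ Ψ f t ↔ 0 < sdMulDensity κ Ψ f t := by
  rw [optDensity_eq, mul_pos_iff_of_pos_left (inv_pos.2 (ENNReal.toReal_pos h0 hc))]

variable [IsMarkovKernel κ]

theorem measurable_sdMulDensity (hΨ : Measurable Ψ) (hf : IsDensity f) :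
    Measurable (sdMulDensity κ Ψ f) :=
  (measurable_condSD κ hΨ).ennreal_toReal.mul hf.measurable

theorem ae_condSD_ne_top (hΨ : Measurable Ψ) (hf : IsDensity f) (hc : optConst κ Ψ f ≠ ∞) :
    ∀ᵐ t, 0 < f t → condSD κ Ψ t ≠ ∞ := by
  have hm : Measurable fun t => condSD κ Ψ t * ENNReal.ofReal (f t) :=
    (measurable_condSD κ hΨ).mul hf.measurable_ofReal
  filter_upwards [ae_lt_top hm hc] with t ht hft htop
  rw [htop, ENNReal.top_mul (ENNReal.ofReal_pos.2 hft).ne'] at ht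
  exact lt_irrefl _ ht

theorem ae_condSD_mul_eq (hΨ : Measurable Ψ) (hf : IsDensity f) (hc : optConst κ Ψ f ≠ ∞) :
    ∀ᵐ t, condSD κ Ψ t * ENNReal.ofReal (f t) = ENNReal.ofReal (sdMulDensity κ Ψ f t) := by
  filter_upwards [ae_condSD_ne_top hΨ hf hc] with t ht
  rw [sdMulDensity, ENNReal.ofReal_mul ENNReal.toReal_nonneg]
  rcases (hf.nonneg t).eq_or_lt with h0 | h0
  · simp [← h0]
  · rw [ENNReal.ofReal_toReal (ht h0)]

theorem lintegral_sdMulDensity (hΨ : Measurable Ψ) (hf : IsDensity f)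
    (hc : optConst κ Ψ f ≠ ∞) :
    ∫⁻ t, ENNReal.ofReal (sdMulDensity κ Ψ f t) = optConst κ Ψ f :=
  (lintegral_congr_ae (ae_condSD_mul_eq hΨ hf hc)).symm

/-- Infinite values of `v` are harmless here: as `c` is finite they occur almost everywhere only
where `f` vanishes, and there both integrands are `0`. -/
theorem sigmaSqSSIS_eq_sdMulDensity (hΨ : Measurable Ψ) (hf : IsDensity f)
    (hc : optConst κ Ψ f ≠ ∞) (g : ℝ → ℝ) :
    sigmaSqSSIS κ Ψ f g
      = ∫⁻ t in {t | 0 < g t}, ENNReal.ofReal (sdMulDensity κ Ψ f t ^ 2 / g t) := by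
  refine lintegral_congr_ae (ae_restrict_of_ae ?_)
  filter_upwards [ae_condSD_mul_eq hΨ hf hc] with t ht
  rw [div_eq_mul_inv, div_eq_mul_inv, ENNReal.ofReal_mul (sq_nonneg _),
    ENNReal.ofReal_mul (sq_nonneg _), ENNReal.ofReal_pow (hf.nonneg t),
    ENNReal.ofReal_pow (sdMulDensity_nonneg hf t), ← ht, ← condSD_sq, mul_pow, mul_assoc]

theorem isDensity_optDensity (hΨ : Measurable Ψ) (hf : IsDensity f) (h0 : optConst κ Ψ f ≠ 0)
    (hc : optConst κ Ψ f ≠ ∞) : IsDensity (optDensity κ Ψ f) := by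
  have hc0 : 0 < (optConst κ Ψ f).toReal := ENNReal.toReal_pos h0 hc
  have heq : optDensity κ Ψ f
      = fun t => (optConst κ Ψ f).toReal⁻¹ * sdMulDensity κ Ψ f t :=
    funext (optDensity_eq κ Ψ f)
  rw [heq]
  refine ⟨(measurable_sdMulDensity hΨ hf).const_mul _, fun t =>
    mul_nonneg (inv_nonneg.2 hc0.le) (sdMulDensity_nonneg hf t), ?_⟩
  simp_rw [ENNReal.ofReal_mul (inv_nonneg.2 hc0.le)]
  rw [lintegral_const_mul _ (measurable_sdMulDensity hΨ hf).ennreal_ofReal,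
    lintegral_sdMulDensity hΨ hf hc, ENNReal.ofReal_inv_of_pos hc0, ENNReal.ofReal_toReal hc,
    ENNReal.inv_mul_cancel h0 hc]

theorem sigmaSqSSIS_optDensity (hΨ : Measurable Ψ) (hf : IsDensity f)
    (h0 : optConst κ Ψ f ≠ 0) (hc : optConst κ Ψ f ≠ ∞) :
    sigmaSqSSIS κ Ψ f (optDensity κ Ψ f) = optConst κ Ψ f ^ 2 := by
  have hg := isDensity_optDensity hΨ hf h0 hc
  have hc0 : 0 < (optConst κ Ψ f).toReal := ENNReal.toReal_pos h0 hc
  rw [sigmaSqSSIS_eq_sdMulDensity hΨ hf hc, ← lintegral_indicator hg.measurableSet_pos]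
  have h1 : ∀ t, ({t | 0 < optDensity κ Ψ f t}.indicator
      (fun t => ENNReal.ofReal (sdMulDensity κ Ψ f t ^ 2 / optDensity κ Ψ f t)) t)
      = optConst κ Ψ f * ENNReal.ofReal (sdMulDensity κ Ψ f t) := by
    intro t
    by_cases ht : 0 < optDensity κ Ψ f t
    · have hs := (optDensity_pos_iff h0 hc t).1 ht
      rw [Set.indicator_of_mem (show t ∈ {t | 0 < optDensity κ Ψ f t} from ht)]
      have h2 : sdMulDensity κ Ψ f t ^ 2 / optDensity κ Ψ f t
          = (optConst κ Ψ f).toReal * sdMulDensity κ Ψ f t := by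
        rw [optDensity_eq]
        field_simp
      rw [h2, ENNReal.ofReal_mul hc0.le, ENNReal.ofReal_toReal hc]
    · rw [Set.indicator_of_notMem (show t ∉ {t | 0 < optDensity κ Ψ f t} from ht),
        ENNReal.ofReal_of_nonpos (not_lt.1 fun h => ht ((optDensity_pos_iff h0 hc t).2 h)),
        mul_zero]
  simp_rw [h1]
  rw [lintegral_const_mul _ (measurable_sdMulDensity hΨ hf).ennreal_ofReal,
    lintegral_sdMulDensity hΨ hf hc, sq]

/-- Completing the square: if `g` charges almost all of the support of `v f` and `σ²(g)` is finite,
then `σ²(g) - c² = ∫ (v f / g - c)² g`, the integral being over `{g > 0}`. It is nonnegative, and it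
vanishes only if `v f = c g` almost everywhere. -/
theorem optConst_sq_le_sigmaSqSSIS (hΨ : Measurable Ψ) (hf : IsDensity f)
    (h0 : optConst κ Ψ f ≠ 0) (hc : optConst κ Ψ f ≠ ∞) (hg : IsDensity g)
    (hsupp : ∀ᵐ t, ¬ 0 < g t → sdMulDensity κ Ψ f t = 0) :
    optConst κ Ψ f ^ 2 ≤ sigmaSqSSIS κ Ψ f g ∧
      (sigmaSqSSIS κ Ψ f g = optConst κ Ψ f ^ 2 → g =ᵐ[volume] optDensity κ Ψ f) := by
  by_cases htop : sigmaSqSSIS κ Ψ f g = ∞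
  · rw [htop]
    exact ⟨le_top, fun h => absurd h.symm (ENNReal.pow_ne_top hc)⟩
  set φ := sdMulDensity κ Ψ f with hφ_def
  set c := (optConst κ Ψ f).toReal with hc_def
  set s : Set ℝ := {t | 0 < g t} with hs_def
  have hs : MeasurableSet s := hg.measurableSet_pos
  have hc0 : 0 < c := ENNReal.toReal_pos h0 hc
  have hφm : Measurable φ := measurable_sdMulDensity hΨ hf
  have hφ0 : ∀ t, 0 ≤ φ t := sdMulDensity_nonneg hf
  have hφl : ∫⁻ t, ENNReal.ofReal (φ t) = optConst κ Ψ f := lintegral_sdMulDensity hΨ hf hc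
  have hφi : Integrable φ := ⟨hφm.aestronglyMeasurable, by
    rw [hasFiniteIntegral_iff_ofReal (ae_of_all _ hφ0), hφl]; exact hc.lt_top⟩
  have hgi : Integrable g := ⟨hg.measurable.aestronglyMeasurable, by
    rw [hasFiniteIntegral_iff_ofReal (ae_of_all _ hg.nonneg), hg.lintegral_eq_one]
    exact ENNReal.one_lt_top⟩
  have hσ := sigmaSqSSIS_eq_sdMulDensity (κ := κ) hΨ hf hc g
  have hq0 : ∀ t, 0 ≤ φ t ^ 2 / g t := fun t => div_nonneg (sq_nonneg _) (hg.nonneg t)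
  have hqm : Measurable fun t => φ t ^ 2 / g t := (hφm.pow_const 2).div hg.measurable
  have hqi : IntegrableOn (fun t => φ t ^ 2 / g t) s := ⟨hqm.aestronglyMeasurable, by
    rw [hasFiniteIntegral_iff_ofReal (ae_of_all _ hq0), ← hσ]; exact Ne.lt_top htop⟩
  have hQ : sigmaSqSSIS κ Ψ f g = ENNReal.ofReal (∫ t in s, φ t ^ 2 / g t) := by
    rw [hσ, ofReal_integral_eq_lintegral_ofReal hqi (ae_of_all _ hq0)]
  have hIφ : ∫ t in s, φ t = c := by
    rw [setIntegral_eq_integral_of_ae_compl_eq_zero (s := s) hsupp,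
      integral_eq_lintegral_of_nonneg_ae (ae_of_all _ hφ0) hφm.aestronglyMeasurable, hφl]
  have hIg : ∫ t in s, g t = 1 := by
    rw [setIntegral_eq_integral_of_forall_compl_eq_zero (s := s)
        fun t ht => le_antisymm (not_lt.1 ht) (hg.nonneg t),
      integral_eq_lintegral_of_nonneg_ae (ae_of_all _ hg.nonneg)
        hg.measurable.aestronglyMeasurable, hg.lintegral_eq_one, ENNReal.toReal_one]
  have hexp : ∀ t ∈ s, (φ t / g t - c) ^ 2 * g t
      = φ t ^ 2 / g t - 2 * c * φ t + c ^ 2 * g t := by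
    intro t ht
    have : g t ≠ 0 := (show 0 < g t from ht).ne'
    field_simp
    ring
  have hi1 : IntegrableOn (fun t => φ t ^ 2 / g t - 2 * c * φ t) s :=
    hqi.sub (hφi.integrableOn.const_mul (2 * c))
  have hi2 : IntegrableOn (fun t => φ t ^ 2 / g t - 2 * c * φ t + c ^ 2 * g t) s :=
    hi1.add (hgi.integrableOn.const_mul (c ^ 2))
  have hsq : ∫ t in s, (φ t / g t - c) ^ 2 * g t = (∫ t in s, φ t ^ 2 / g t) - c ^ 2 := by
    rw [setIntegral_congr_fun hs hexp, integral_add hi1 (hgi.integrableOn.const_mul (c ^ 2)),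
      integral_sub hqi (hφi.integrableOn.const_mul (2 * c)), integral_const_mul,
      integral_const_mul, hIφ, hIg]
    ring
  have hnn : ∀ t, 0 ≤ (φ t / g t - c) ^ 2 * g t := fun t => mul_nonneg (sq_nonneg _) (hg.nonneg t)
  have hnonneg : 0 ≤ ∫ t in s, (φ t / g t - c) ^ 2 * g t := integral_nonneg hnn
  have hcc : optConst κ Ψ f ^ 2 = ENNReal.ofReal (c ^ 2) := by
    rw [ENNReal.ofReal_pow hc0.le, hc_def, ENNReal.ofReal_toReal hc]
  rw [hQ, hcc]
  refine ⟨ENNReal.ofReal_le_ofReal (by linarith), fun heq => ?_⟩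
  rw [ENNReal.ofReal_eq_ofReal_iff (by linarith [sq_nonneg c]) (sq_nonneg c)] at heq
  have hzero : ∫ t in s, (φ t / g t - c) ^ 2 * g t = 0 := by rw [hsq, heq, sub_self]
  have hint : IntegrableOn (fun t => (φ t / g t - c) ^ 2 * g t) s :=
    hi2.congr_fun (fun t ht => (hexp t ht).symm) hs
  have hae := (integral_eq_zero_iff_of_nonneg hnn hint).1 hzero
  filter_upwards [(ae_restrict_iff' hs).1 hae, hsupp] with t h1 h2
  rw [optDensity_eq, ← hφ_def, ← hc_def]
  by_cases ht : 0 < g t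
  · have h3 := h1 ht
    simp only [Pi.zero_apply, mul_eq_zero, ht.ne', or_false, ne_eq, OfNat.ofNat_ne_zero,
      not_false_eq_true, pow_eq_zero_iff, sub_eq_zero] at h3
    rw [div_eq_iff ht.ne'] at h3
    rw [h3]
    field_simp
  · rw [h2 ht, mul_zero]
    exact le_antisymm (not_lt.1 ht) (hg.nonneg t)

end Optimal

end

/-! ### Unbiased proposals -/

section

theorem ae_densityMeasure_iff {f : ℝ → ℝ} (hf : IsDensity f) {p : ℝ → Prop} :
    (∀ᵐ t ∂(densityMeasure f), p t) ↔ ∀ᵐ t, 0 < f t → p t := by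
  rw [densityMeasure, ae_withDensity_iff hf.measurable_ofReal]
  simp [ENNReal.ofReal_eq_zero]

theorem setIntegral_eq_integral_iff_of_signed {M : ℝ → ℝ} (hM : Integrable M)
    (hsign : (∀ᵐ t, 0 ≤ M t) ∨ ∀ᵐ t, M t ≤ 0) {s : Set ℝ} (hs : MeasurableSet s) :
    ∫ t in s, M t = ∫ t, M t ↔ ∀ᵐ t, t ∉ s → M t = 0 := by
  have h1 : ∫ t in s, M t = ∫ t, M t ↔ ∫ t in sᶜ, M t = 0 := by
    rw [← integral_add_compl hs hM]
    constructor <;> intro h <;> linarith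
  have h2 : (∀ᵐ t, t ∉ s → M t = 0) ↔ M =ᵐ[volume.restrict sᶜ] 0 :=
    (ae_restrict_iff' hs.compl).symm
  rw [h1, h2]
  rcases hsign with h | h
  · exact setIntegral_eq_zero_iff_of_nonneg_ae (ae_restrict_of_ae h) hM.integrableOn
  · have h3 := setIntegral_eq_zero_iff_of_nonneg_ae (s := sᶜ) (f := fun t => -M t)
      (ae_restrict_of_ae (h.mono fun t ht => neg_nonneg.2 ht)) hM.neg.integrableOn
    rw [integral_neg, neg_eq_zero] at h3
    rw [h3]
    constructor <;> intro h <;> filter_upwards [h] with t ht <;> simpa using ht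

variable {E : Type*} [MeasurableSpace E] {κ : Kernel ℝ E} [IsMarkovKernel κ] {Ψ : E → ℝ}
  {f g : ℝ → ℝ}

theorem integrable_condMean_mul (hf : IsDensity f)
    (hint : Integrable (fun p : ℝ × E => Ψ p.2) (densityMeasure f ⊗ₘ κ)) :
    Integrable (fun t => condMean κ Ψ t * f t) := by
  have := hf.isProbabilityMeasure
  have h1 : Integrable (condMean κ Ψ) (densityMeasure f) := by
    rw [Measure.compProd] at hint
    exact hint.integral_compProd
  rw [densityMeasure, integrable_withDensity_iff hf.measurable_ofReal
    (ae_of_all _ fun _ => ENNReal.ofReal_lt_top)] at h1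
  refine h1.congr (ae_of_all _ fun t => ?_)
  simp only [ENNReal.toReal_ofReal (hf.nonneg t)]

theorem integral_condMean_mul (hf : IsDensity f)
    (hint : Integrable (fun p : ℝ × E => Ψ p.2) (densityMeasure f ⊗ₘ κ)) :
    ∫ p, Ψ p.2 ∂(densityMeasure f ⊗ₘ κ) = ∫ t, condMean κ Ψ t * f t := by
  have := hf.isProbabilityMeasure
  rw [Measure.integral_compProd hint]
  change ∫ t, condMean κ Ψ t ∂(densityMeasure f) = _
  rw [integral_densityMeasure hf]
  refine setIntegral_eq_integral_of_forall_compl_eq_zero fun t ht => ?_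
  rw [le_antisymm (not_lt.1 ht) (hf.nonneg t), mul_zero]

theorem condMean_mul_signed (hf : IsDensity f)
    (hsign : (∀ᵐ p ∂(densityMeasure f ⊗ₘ κ), 0 ≤ Ψ p.2) ∨
      ∀ᵐ p ∂(densityMeasure f ⊗ₘ κ), Ψ p.2 ≤ 0) :
    (∀ᵐ t, 0 ≤ condMean κ Ψ t * f t) ∨ ∀ᵐ t, condMean κ Ψ t * f t ≤ 0 := by
  have := hf.isProbabilityMeasure
  refine hsign.imp (fun h => ?_) fun h => ?_
  · filter_upwards [(ae_densityMeasure_iff hf).1 (Measure.ae_ae_of_ae_compProd h)] with t ht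
    rcases (hf.nonneg t).eq_or_lt with h0 | h0
    · simp [← h0]
    · exact mul_nonneg (integral_nonneg_of_ae (ht h0)) h0.le
  · filter_upwards [(ae_densityMeasure_iff hf).1 (Measure.ae_ae_of_ae_compProd h)] with t ht
    rcases (hf.nonneg t).eq_or_lt with h0 | h0
    · simp [← h0]
    · exact mul_nonpos_of_nonpos_of_nonneg (integral_nonpos_of_ae (ht h0)) h0.le

/-- As `Ψ` does not change sign, it vanishes given `T = t` whenever its conditional mean does. -/
theorem ae_condVar_eq_zero_of_condMean (hf : IsDensity f)
    (hint : Integrable (fun p : ℝ × E => Ψ p.2) (densityMeasure f ⊗ₘ κ))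
    (hsign : (∀ᵐ p ∂(densityMeasure f ⊗ₘ κ), 0 ≤ Ψ p.2) ∨
      ∀ᵐ p ∂(densityMeasure f ⊗ₘ κ), Ψ p.2 ≤ 0) :
    ∀ᵐ t, 0 < f t → condMean κ Ψ t = 0 → condVar κ Ψ t = 0 := by
  have := hf.isProbabilityMeasure
  have hi := (ae_densityMeasure_iff hf).1 ((Measure.integrable_compProd_iff hint.1).1 hint).1
  have hzero : ∀ t, condMean κ Ψ t = 0 → Integrable Ψ (κ t) → Ψ =ᵐ[κ t] 0 →
      condVar κ Ψ t = 0 := fun t hm hit h => by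
    rw [condVar, evariance_eq_zero_iff hit.1.aemeasurable]
    filter_upwards [h] with x hx
    rw [hx]
    exact hm.symm
  rcases hsign with h | h
  · filter_upwards [hi, (ae_densityMeasure_iff hf).1 (Measure.ae_ae_of_ae_compProd h)]
      with t h1 h2 h0 hm
    exact hzero t hm (h1 h0) ((integral_eq_zero_iff_of_nonneg_ae (h2 h0) (h1 h0)).1 hm)
  · filter_upwards [hi, (ae_densityMeasure_iff hf).1 (Measure.ae_ae_of_ae_compProd h)]
      with t h1 h2 h0 hm
    refine hzero t hm (h1 h0) ?_
    have h3 := (integral_eq_zero_iff_of_nonneg_ae (f := fun x => -Ψ x)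
      ((h2 h0).mono fun x hx => neg_nonneg.2 hx) (h1 h0).neg).1
      (by rw [integral_neg, neg_eq_zero]; exact hm)
    filter_upwards [h3] with x hx
    simpa using hx

/-- Since `m f` does not change sign, `∫_{g > 0} m f` equals `∫ m f` if and only if `m f` vanishes
almost everywhere outside `{g > 0}`. -/
theorem muSIS_eq_iff (hf : IsDensity f) (hg : IsDensity g)
    (hint : Integrable (fun p : ℝ × E => Ψ p.2) (densityMeasure f ⊗ₘ κ))
    (hsign : (∀ᵐ p ∂(densityMeasure f ⊗ₘ κ), 0 ≤ Ψ p.2) ∨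
      ∀ᵐ p ∂(densityMeasure f ⊗ₘ κ), Ψ p.2 ≤ 0) :
    muSIS κ Ψ f g = ∫ p, Ψ p.2 ∂(densityMeasure f ⊗ₘ κ) ↔
      ∀ᵐ t, ¬ 0 < g t → condMean κ Ψ t * f t = 0 := by
  rw [integral_condMean_mul hf hint]
  exact setIntegral_eq_integral_iff_of_signed (integrable_condMean_mul hf hint)
    (condMean_mul_signed hf hsign) hg.measurableSet_pos

theorem isUnbiased_iff (hΨ : Measurable Ψ) (hf : IsDensity f) (hg : IsDensity g)
    (hint : Integrable (fun p : ℝ × E => Ψ p.2) (densityMeasure f ⊗ₘ κ)) (μ : ℝ) :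
    IsUnbiased κ Ψ f g μ ↔ muSIS κ Ψ f g = μ := by
  have h := fun (n : ℕ) (hn : 1 ≤ n) =>
    integral_estimator hg (integrable_summand hΨ hf hg hint) hn
  exact ⟨fun hu => (h 1 le_rfl).symm.trans (hu 1 le_rfl), fun hu n hn => (h n hn).trans hu⟩

/-- The proposal `c⁻¹ v f` is unbiased exactly if `m` vanishes almost surely where `v` does. -/
theorem muSIS_optDensity_eq_iff (hΨ : Measurable Ψ) (hf : IsDensity f)
    (hint : Integrable (fun p : ℝ × E => Ψ p.2) (densityMeasure f ⊗ₘ κ))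
    (hsign : (∀ᵐ p ∂(densityMeasure f ⊗ₘ κ), 0 ≤ Ψ p.2) ∨
      ∀ᵐ p ∂(densityMeasure f ⊗ₘ κ), Ψ p.2 ≤ 0)
    (h0 : optConst κ Ψ f ≠ 0) (hc : optConst κ Ψ f ≠ ∞) :
    muSIS κ Ψ f (optDensity κ Ψ f) = ∫ p, Ψ p.2 ∂(densityMeasure f ⊗ₘ κ) ↔
      densityMeasure f {t | condVar κ Ψ t = 0 ∧ condMean κ Ψ t ≠ 0} = 0 := by
  have h1 : densityMeasure f {t | condVar κ Ψ t = 0 ∧ condMean κ Ψ t ≠ 0} = 0 ↔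
      ∀ᵐ t ∂(densityMeasure f), ¬ (condVar κ Ψ t = 0 ∧ condMean κ Ψ t ≠ 0) := by
    rw [ae_iff]; simp only [not_not]
  rw [muSIS_eq_iff hf (isDensity_optDensity hΨ hf h0 hc) hint hsign, h1,
    ae_densityMeasure_iff hf]
  refine eventually_congr ?_
  filter_upwards [ae_condSD_ne_top hΨ hf hc] with t ht
  rw [optDensity_pos_iff h0 hc, sdMulDensity]
  rcases (hf.nonneg t).eq_or_lt with hft | hft
  · simp [← hft]
  · have h2 : ¬ 0 < (condSD κ Ψ t).toReal * f t ↔ condVar κ Ψ t = 0 := by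
      rw [mul_pos_iff_of_pos_right hft, ← condSD_eq_zero_iff, ENNReal.toReal_pos_iff,
        not_and_or, not_lt, nonpos_iff_eq_zero]
      simp [ht hft]
    rw [h2]
    simp [hft, hft.ne']

/-- If `g` is unbiased it charges almost all of the support of `v f`: outside `{g > 0}` the mean `m`
vanishes, hence so does `v`, because `Ψ` does not change sign. -/
theorem sdMulDensity_eq_zero_of_unbiased (hf : IsDensity f) (hg : IsDensity g)
    (hint : Integrable (fun p : ℝ × E => Ψ p.2) (densityMeasure f ⊗ₘ κ))
    (hsign : (∀ᵐ p ∂(densityMeasure f ⊗ₘ κ), 0 ≤ Ψ p.2) ∨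
      ∀ᵐ p ∂(densityMeasure f ⊗ₘ κ), Ψ p.2 ≤ 0)
    (hu : muSIS κ Ψ f g = ∫ p, Ψ p.2 ∂(densityMeasure f ⊗ₘ κ)) :
    ∀ᵐ t, ¬ 0 < g t → sdMulDensity κ Ψ f t = 0 := by
  filter_upwards [(muSIS_eq_iff hf hg hint hsign).1 hu,
    ae_condVar_eq_zero_of_condMean hf hint hsign] with t h1 h2 hgt
  rcases (hf.nonneg t).eq_or_lt with hft | hft
  · rw [sdMulDensity, ← hft, mul_zero]
  · have hm : condMean κ Ψ t = 0 := (mul_eq_zero.1 (h1 hgt)).resolve_right hft.ne'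
    rw [sdMulDensity, (condSD_eq_zero_iff κ Ψ t).2 (h2 hft hm), ENNReal.toReal_zero, zero_mul]

/-- A strict inequality between the asymptotic variances, the smaller one being finite, is
inherited by the variances for large sample sizes. -/
theorem eventually_evariance_lt {g' : ℝ → ℝ} (hΨ : Measurable Ψ) (hf : IsDensity f)
    (hg : IsDensity g) (hg' : IsDensity g')
    (hL : MemLp (summand Ψ f g) 2 (densityMeasure g ⊗ₘ κ))
    (hlt : sigmaSqSSIS κ Ψ f g < sigmaSqSSIS κ Ψ f g') :
    ∀ᶠ n : ℕ in atTop, evariance (estimator Ψ f g n) (sampleLaw κ g n)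
      < evariance (estimator Ψ f g' n) (sampleLaw κ g' n) := by
  -- without the moment condition for `g'` its estimator has infinite variance for every `n ≥ 1`
  by_cases hL' : MemLp (summand Ψ f g') 2 (densityMeasure g' ⊗ₘ κ)
  · have hfin : sigmaSqSSIS κ Ψ f g' ≠ ∞ := by
      rw [sigmaSqSSIS_eq_ofReal κ hΨ hf hg' hL']; exact ENNReal.ofReal_ne_top
    have hlt' := (ENNReal.toReal_lt_toReal hlt.ne_top hfin).2 hlt
    filter_upwards [eventually_ge_atTop 1,
      (tendsto_mul_variance_estimator hΨ hf hg hL).eventually_lt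
        (tendsto_mul_variance_estimator hΨ hf hg' hL') hlt'] with n hn h
    have hn0 : (0 : ℝ) < n := by positivity
    have h1 := lt_of_mul_lt_mul_left h hn0.le
    rw [← ofReal_variance (memLp_estimator hg hL hn),
      ← ofReal_variance (memLp_estimator hg' hL' hn)]
    exact (ENNReal.ofReal_lt_ofReal_iff ((variance_nonneg _ _).trans_lt h1)).2 h1
  · filter_upwards [eventually_ge_atTop 1] with n hn
    have hest : AEStronglyMeasurable (estimator Ψ f g' n) (sampleLaw κ g' n) :=
      ((Finset.measurable_sum _ fun i _ => (measurable_summand hΨ hf hg').comp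
        (measurable_pi_apply i)).const_mul _).aestronglyMeasurable
    rw [evariance_eq_top hest fun h => hL' (memLp_summand_of_memLp_estimator hΨ hf hg' hn h)]
    exact evariance_lt_top (memLp_estimator hg hL hn)

end

end SSIS

theorem mainTheorem2
    {Ω : Type*} [MeasurableSpace Ω] (P : Measure Ω) [IsProbabilityMeasure P]
    {d : ℕ} (X : Ω → (Fin d → ℝ)) (hX : Measurable X)
    (τ : (Fin d → ℝ) → ℝ) (hτ : Measurable τ)
    (Ψ : (Fin d → ℝ) → ℝ) (hΨ : Measurable Ψ)
    (hint : Integrable (fun ω => Ψ (X ω)) P)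
    -- the index `T = τ(X)` has density `f`
    (f : ℝ → ℝ) (hf : SSIS.IsDensity f)
    (hfT : P.map (fun ω => τ (X ω)) = SSIS.densityMeasure f)
    -- `κ` is a version of the regular conditional distribution of `X` given `T`
    (κ : Kernel ℝ (Fin d → ℝ)) [IsMarkovKernel κ]
    (hκ : P.map (fun ω => τ (X ω)) ⊗ₘ κ = P.map (fun ω => (τ (X ω), X ω))) :
    -- mean
    (∀ g : ℝ → ℝ, SSIS.IsDensity g → ∀ n : ℕ, 1 ≤ n →
      Integrable (SSIS.estimator Ψ f g n) (SSIS.sampleLaw κ g n) ∧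
      ∫ s, SSIS.estimator Ψ f g n s ∂(SSIS.sampleLaw κ g n) = SSIS.muSIS κ Ψ f g) ∧
    -- variance
    (∀ g : ℝ → ℝ, SSIS.IsDensity g → SSIS.weightedSecondMoment κ Ψ f g ≠ ∞ →
      SSIS.sigmaSqSSIS κ Ψ f g ≠ ∞ ∧
      (∀ n : ℕ, 1 ≤ n → MemLp (SSIS.estimator Ψ f g n) 2 (SSIS.sampleLaw κ g n)) ∧
      (fun n : ℕ => variance (SSIS.estimator Ψ f g n) (SSIS.sampleLaw κ g n)
          - (SSIS.sigmaSqSSIS κ Ψ f g).toReal / n) =o[atTop] (fun n : ℕ => 1 / (n : ℝ))) ∧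
    -- asymptotic normality
    (∀ g : ℝ → ℝ, SSIS.IsDensity g → SSIS.weightedSecondMoment κ Ψ f g ≠ ∞ →
      (∃ δ : ℝ, 0 < δ ∧ SSIS.weightedMeanMoment κ Ψ f g (2 + δ) ≠ ∞) →
      TendstoInDistribution
        (fun (n : ℕ) s => √(n : ℝ) * (SSIS.estimator Ψ f g n s - SSIS.muSIS κ Ψ f g))
        atTop (id : ℝ → ℝ) (fun n => SSIS.sampleLaw κ g n)
        (gaussianReal 0 (SSIS.sigmaSqSSIS κ Ψ f g).toNNReal)) ∧
    -- optimal proposal, when `Ψ` does not change sign and `0 < c < ∞`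
    (((∀ᵐ ω ∂P, 0 ≤ Ψ (X ω)) ∨ (∀ᵐ ω ∂P, Ψ (X ω) ≤ 0)) →
      SSIS.optConst κ Ψ f ≠ 0 → SSIS.optConst κ Ψ f ≠ ∞ →
      SSIS.IsDensity (SSIS.optDensity κ Ψ f) ∧
      (P {ω | SSIS.condVar κ Ψ (τ (X ω)) = 0 ∧ SSIS.condMean κ Ψ (τ (X ω)) ≠ 0} = 0 →
        -- `c⁻¹ v f` is unbiased and is the unique unbiased proposal with the smallest `σ²_SSIS`
        SSIS.IsUnbiased κ Ψ f (SSIS.optDensity κ Ψ f) (∫ ω, Ψ (X ω) ∂P) ∧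
        SSIS.sigmaSqSSIS κ Ψ f (SSIS.optDensity κ Ψ f) = SSIS.optConst κ Ψ f ^ 2 ∧
        (∀ g : ℝ → ℝ, SSIS.IsDensity g → SSIS.IsUnbiased κ Ψ f g (∫ ω, Ψ (X ω) ∂P) →
          SSIS.optConst κ Ψ f ^ 2 ≤ SSIS.sigmaSqSSIS κ Ψ f g ∧
          (SSIS.sigmaSqSSIS κ Ψ f g = SSIS.optConst κ Ψ f ^ 2 →
            g =ᵐ[volume] SSIS.optDensity κ Ψ f)) ∧
        -- its variance is `c²/n + o(1/n)`, eventually below that of any other unbiased proposal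
        (SSIS.weightedSecondMoment κ Ψ f (SSIS.optDensity κ Ψ f) ≠ ∞ →
          (∀ n : ℕ, 1 ≤ n → MemLp (SSIS.estimator Ψ f (SSIS.optDensity κ Ψ f) n) 2
            (SSIS.sampleLaw κ (SSIS.optDensity κ Ψ f) n)) ∧
          (fun n : ℕ => variance (SSIS.estimator Ψ f (SSIS.optDensity κ Ψ f) n)
              (SSIS.sampleLaw κ (SSIS.optDensity κ Ψ f) n)
              - (SSIS.optConst κ Ψ f).toReal ^ 2 / n) =o[atTop] (fun n : ℕ => 1 / (n : ℝ)) ∧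
          (∀ g : ℝ → ℝ, SSIS.IsDensity g → SSIS.IsUnbiased κ Ψ f g (∫ ω, Ψ (X ω) ∂P) →
            ¬ g =ᵐ[volume] SSIS.optDensity κ Ψ f →
            ∀ᶠ n : ℕ in atTop,
              evariance (SSIS.estimator Ψ f (SSIS.optDensity κ Ψ f) n)
                  (SSIS.sampleLaw κ (SSIS.optDensity κ Ψ f) n)
                < evariance (SSIS.estimator Ψ f g n) (SSIS.sampleLaw κ g n)))) ∧
      -- bias of `c⁻¹ v f` otherwise
      (0 < P {ω | SSIS.condVar κ Ψ (τ (X ω)) = 0 ∧ SSIS.condMean κ Ψ (τ (X ω)) ≠ 0} →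
        ∀ n : ℕ, 1 ≤ n →
          ∫ s, SSIS.estimator Ψ f (SSIS.optDensity κ Ψ f) n s
            ∂(SSIS.sampleLaw κ (SSIS.optDensity κ Ψ f) n) ≠ ∫ ω, Ψ (X ω) ∂P)) := by
  have hX2 : Measurable fun ω => (τ (X ω), X ω) := (hτ.comp hX).prodMk hX
  have hJ : P.map (fun ω => (τ (X ω), X ω)) = SSIS.densityMeasure f ⊗ₘ κ := by rw [← hκ, hfT]
  have hΨ2 : Measurable fun p : ℝ × (Fin d → ℝ) => Ψ p.2 := hΨ.comp measurable_snd
  have hintJ : Integrable (fun p : ℝ × (Fin d → ℝ) => Ψ p.2) (SSIS.densityMeasure f ⊗ₘ κ) := by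
    rw [← hJ, integrable_map_measure hΨ2.aestronglyMeasurable hX2.aemeasurable]
    exact hint
  have hμ : ∫ ω, Ψ (X ω) ∂P = ∫ p, Ψ p.2 ∂(SSIS.densityMeasure f ⊗ₘ κ) := by
    rw [← hJ, integral_map hX2.aemeasurable hΨ2.aestronglyMeasurable]
  have hsummand := fun (g : ℝ → ℝ) (hg : SSIS.IsDensity g) =>
    SSIS.integrable_summand (κ := κ) hΨ hf hg hintJ
  have hL := fun (g : ℝ → ℝ) (hg : SSIS.IsDensity g) =>
    SSIS.weightedSecondMoment_ne_top_iff κ hΨ hf hg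
  refine ⟨fun g hg n hn => ⟨SSIS.integrable_estimator hg (hsummand g hg) hn,
    SSIS.integral_estimator hg (hsummand g hg) hn⟩, fun g hg hw => ?_, fun g hg hw _ =>
    SSIS.tendstoInDistribution_estimator hΨ hf hg ((hL g hg).1 hw), fun hsign h0 hc => ?_⟩
  · have h := (hL g hg).1 hw
    refine ⟨?_, fun n hn => SSIS.memLp_estimator hg h hn,
      SSIS.isLittleO_variance_estimator hΨ hf hg h⟩
    rw [SSIS.sigmaSqSSIS_eq_ofReal κ hΨ hf hg h]
    exact ENNReal.ofReal_ne_top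
  · have hsignJ : (∀ᵐ p ∂(SSIS.densityMeasure f ⊗ₘ κ), 0 ≤ Ψ p.2) ∨
        ∀ᵐ p ∂(SSIS.densityMeasure f ⊗ₘ κ), Ψ p.2 ≤ 0 := by
      rw [← hJ, ae_map_iff hX2.aemeasurable (measurableSet_le measurable_const hΨ2),
        ae_map_iff hX2.aemeasurable (measurableSet_le hΨ2 measurable_const)]
      exact hsign
    have hopt := SSIS.isDensity_optDensity (κ := κ) hΨ hf h0 hc
    have hσopt := SSIS.sigmaSqSSIS_optDensity (κ := κ) hΨ hf h0 hc
    have hset : P {ω | SSIS.condVar κ Ψ (τ (X ω)) = 0 ∧ SSIS.condMean κ Ψ (τ (X ω)) ≠ 0}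
        = SSIS.densityMeasure f {t | SSIS.condVar κ Ψ t = 0 ∧ SSIS.condMean κ Ψ t ≠ 0} := by
      have hT : Measurable fun ω => τ (X ω) := hτ.comp hX
      rw [← hfT, Measure.map_apply hT]
      · rfl
      · exact (SSIS.measurable_condVar κ hΨ (measurableSet_singleton 0)).inter
          (SSIS.measurable_condMean κ hΨ (measurableSet_singleton 0).compl)
    have hbias := SSIS.muSIS_optDensity_eq_iff hΨ hf hintJ hsignJ h0 hc
    rw [hset, hμ]
    refine ⟨hopt, fun hnull => ?_, fun hpos n hn => ?_⟩
    · have hlower : ∀ g : ℝ → ℝ, SSIS.IsDensity g →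
          SSIS.IsUnbiased κ Ψ f g (∫ p, Ψ p.2 ∂(SSIS.densityMeasure f ⊗ₘ κ)) →
          SSIS.optConst κ Ψ f ^ 2 ≤ SSIS.sigmaSqSSIS κ Ψ f g ∧
          (SSIS.sigmaSqSSIS κ Ψ f g = SSIS.optConst κ Ψ f ^ 2 →
            g =ᵐ[volume] SSIS.optDensity κ Ψ f) := fun g hg hu =>
        SSIS.optConst_sq_le_sigmaSqSSIS hΨ hf h0 hc hg
          (SSIS.sdMulDensity_eq_zero_of_unbiased hf hg hintJ hsignJ
            ((SSIS.isUnbiased_iff hΨ hf hg hintJ _).1 hu))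
      refine ⟨(SSIS.isUnbiased_iff hΨ hf hopt hintJ _).2 (hbias.2 hnull), hσopt, hlower,
        fun hw => ?_⟩
      have h := (hL _ hopt).1 hw
      refine ⟨fun n hn => SSIS.memLp_estimator hopt h hn, ?_, fun g hg hu hne => ?_⟩
      · have h1 := SSIS.isLittleO_variance_estimator hΨ hf hopt h
        rwa [hσopt, ENNReal.toReal_pow] at h1
      · obtain ⟨h1, h2⟩ := hlower g hg hu
        refine SSIS.eventually_evariance_lt hΨ hf hopt hg h ?_
        rw [hσopt]
        exact lt_of_le_of_ne h1 fun heq => hne (h2 heq.symm)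
    · rw [SSIS.integral_estimator hopt (hsummand _ hopt) hn]
      exact fun h => hpos.ne' (hbias.1 h)
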